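/- Let $\mathbb{F}_q$ be the finite field with $q$ elements, let $n\ge 1$ be an integer, and let $g\in\mathbb{F}_q[x]$ (not necessarily monic) have degree $\delta\ge 1$. Let $R(n,g,q)$ be the number of monic polynomials $f\in\mathbb{F}_q[x]$ of degree $n$ that can be written in the form $f=h+g^k$, where $h\in\mathbb{F}_q[x]$ is a monic irreducible polynomial of degree $n$ and $k\ge 0$ is an integer, and put $r(n,g,q)=R(n,g,q)/q^n$. Let $\gamma$ denote Euler's constant. Then, for all such $q$, $n$ and $g$, $$\frac{1+\delta/n}{\delta}\ \ge\ r(n,g,q)\ >\ \frac{\left(1-2q^{-n/2}\right)^2\left(1+\delta/n\right)^{-1}}{\delta+8\,\frac{q}{q-1}\left(1+e^{\gamma}\min\left\{5\sqrt{\delta/q},\ \frac{\log(6\delta)}{\log q}\right\}\right)}.$$ -/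

import Mathlib

open scoped Polynomial

/-- The set of monic polynomials `f` of degree `n` over `F` which can be written as
`f = h + g ^ k` with `h` monic irreducible of degree `n` and `k` a nonnegative integer. -/
def romanoffSet {F : Type*} [Field F] (n : ℕ) (g : F[X]) : Set F[X] :=
  {f | f.Monic ∧ f.natDegree = n ∧
    ∃ (h : F[X]) (k : ℕ), h.Monic ∧ Irreducible h ∧ h.natDegree = n ∧ f = h + g ^ k}

/-- `R(n,g,q)`: the number of polynomials in `romanoffSet n g`. -/
noncomputable def romanoffCount {F : Type*} [Field F] (n : ℕ) (g : F[X]) : ℕ :=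
  (romanoffSet n g).ncard

/-- `r(n,g,q) = R(n,g,q) / q ^ n`, where `q` is the order of the finite field `F`. -/
noncomputable def romanoffDensity {F : Type*} [Field F] [Fintype F] (n : ℕ) (g : F[X]) : ℝ :=
  (romanoffCount n g : ℝ) / (Fintype.card F : ℝ) ^ n

/-! This is Romanoff's second-moment argument over F_q[x]. Write π for the number of monic
irreducibles of degree n and |P| = q^(deg P). Since f and h are both monic of degree n, only
exponents with kδ < n occur. Their number K satisfies n ≤ Kδ ≤ n + δ, and the upper bound follows
from R ≤ πK and nπ ≤ q^n.

For the lower bound, let r(f) be the number of representations of f. Cauchy–Schwarz gives (πK)² ≤ R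
· ∑ r(f)². The diagonal part of the second moment is Kπ. Off the diagonal one counts monic
irreducible h of degree n for which h + (g^l − g^k) is irreducible as well. A Selberg sieve with
primes of degree at most n/2, which has no error term here, bounds this by 8 q/(q−1) · q^n/n² · ∏ (1
+ 1/|P|) over the primes P dividing g^l − g^k (`card_twin_le`).

It remains to average that product over k < l (`sum_prod_primeDivisors_le`). After expansion, a set
E of primes contributes only if the lcm ε(E) of the orders of g modulo its members divides l − k, so
it carries the weight 1/ε(E). Abel summation in ε leaves, for each i, the primes dividing g or
modulo which g has order at most i. All of them divide one polynomial of degree δ(2 + i(i−1)/2)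
(`orderProduct`). For a polynomial of degree d ≥ 2 the product is at most 1 + e^γ log d / log q, a
Mertens bound obtained from harmonic numbers, and at most 1 + e^γ d/q if d ≤ q. Averaged over i with
weights 1/(i(i+1)), the first bound yields log(6δ)/log q, and both together yield 5√(δ/q)
(`abelSum_le_min`). -/

/-! ### Harmonic numbers and explicit inequalities with e^γ -/

theorem log_succ_sub_log_le (m : ℕ) (hm : 1 ≤ m) :
    Real.log ((m + 1 : ℕ) + 11 / 20) - Real.log (m + 11 / 20) ≤ 1 / ((m : ℝ) + 1) := by
  have hm' : (1 : ℝ) ≤ m := by exact_mod_cast hm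
  rw [← Real.log_div (by positivity) (by positivity), Real.log_le_iff_le_exp (by positivity)]
  -- In terms of y the claim is 1 + 11y/20 ≤ e^y (1 − 9y/20); the cubic Taylor polynomial of e^y
  -- suffices for y ≤ 1/2.
  set y : ℝ := 1 / ((m : ℝ) + 1) with hy
  have hy0 : 0 < y := by positivity
  have hy1 : y ≤ 1 / 2 := by
    rw [hy]; exact one_div_le_one_div_of_le (by norm_num) (by linarith)
  have hm2 : (m : ℝ) = 1 / y - 1 := by rw [hy]; field_simp; ring
  have h4 := Real.sum_le_exp_of_nonneg hy0.le 4
  simp only [Finset.sum_range_succ, Nat.factorial] at h4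
  norm_num at h4
  refine le_trans ?_ h4
  rw [div_le_iff₀ (by positivity)]
  push_cast
  rw [hm2]
  have e1 : (1 / y - 1 + 1 + 11 / 20) = (1 + 11 / 20 * y) / y := by field_simp; ring
  have e2 : (1 / y - 1 + 11 / 20) = (1 - 9 / 20 * y) / y := by field_simp; ring
  rw [e1, e2, show (1 + y + y ^ 2 / 2 + y ^ 3 / 6) * ((1 - 9 / 20 * y) / y)
    = ((1 + y + y ^ 2 / 2 + y ^ 3 / 6) * (1 - 9 / 20 * y)) / y by ring]
  refine div_le_div_of_nonneg_right ?_ hy0.le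
  nlinarith [mul_nonneg (sq_nonneg y) (sub_nonneg.2 hy1),
    mul_nonneg (pow_nonneg hy0.le 3) (sub_nonneg.2 hy1), pow_nonneg hy0.le 2]

/-- The sequence increases to γ. A shift above 1/2 is needed for monotonicity; 11/20 works from m =
1 on and still satisfies (11/20) e^γ ≤ 1, which `exp_harmonic_le` needs. -/
theorem harmonic_sub_log_le (m : ℕ) (hm : 1 ≤ m) :
    (harmonic m : ℝ) - Real.log (m + 11 / 20) ≤ Real.eulerMascheroniConstant := by
  have hmono : MonotoneOn (fun m : ℕ => (harmonic m : ℝ) - Real.log (m + 11 / 20)) (Set.Ici 1) := by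
    refine monotoneOn_nat_Ici_of_le_succ fun k hk => ?_
    have := log_succ_sub_log_le k hk
    simp only [harmonic_succ]
    push_cast at this ⊢
    rw [one_div] at this
    linarith
  refine ge_of_tendsto Real.tendsto_harmonic_sub_log ?_
  filter_upwards [Filter.eventually_ge_atTop m] with k hk
  have h1 : (harmonic m : ℝ) - Real.log (m + 11 / 20)
      ≤ (harmonic k : ℝ) - Real.log (k + 11 / 20) := hmono hm (hm.trans hk) hk
  have hk' : (1 : ℝ) ≤ k := by exact_mod_cast hm.trans hk
  have h2 : Real.log k ≤ Real.log (k + 11 / 20) := Real.log_le_log (by linarith) (by linarith)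
  linarith

theorem exp_eulerMascheroniConstant_le :
    Real.exp Real.eulerMascheroniConstant ≤ 20 / 11 := by
  -- H_m − log m decreases to γ. At m = 32 the logarithm is 5 log 2 and the value is below 0.593 <
  -- log(20/11).
  have h := Real.eulerMascheroniConstant_lt_eulerMascheroniSeq' 32
  have e : Real.eulerMascheroniSeq' 32 = (harmonic 32 : ℝ) - 5 * Real.log 2 := by
    rw [Real.eulerMascheroniSeq']
    rw [show ((32 : ℕ) : ℝ) = 2 ^ 5 by norm_num, Real.log_pow]
    norm_num
  have hH : (harmonic 32 : ℝ) ≤ 40585 / 10000 := by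
    simp only [harmonic, Finset.sum_range_succ]
    norm_num
  have hl := Real.log_two_gt_d9
  have hγ : Real.eulerMascheroniConstant ≤ 593 / 1000 := by
    rw [e] at h
    norm_num at hl ⊢
    linarith
  refine (Real.exp_le_exp.2 hγ).trans ?_
  refine (Real.exp_bound' (n := 6) (by norm_num) (by norm_num) (by norm_num)).trans ?_
  simp only [Finset.sum_range_succ, Nat.factorial]
  norm_num

theorem exp_harmonic_le (m : ℕ) :
    Real.exp (harmonic m) ≤ 1 + Real.exp Real.eulerMascheroniConstant * m := by
  rcases Nat.eq_zero_or_pos m with rfl | hm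
  · simp
  have h := harmonic_sub_log_le m hm
  have hm' : (1 : ℝ) ≤ m := by exact_mod_cast hm
  have h2 : Real.exp (harmonic m)
      ≤ Real.exp (Real.eulerMascheroniConstant + Real.log (m + 11 / 20)) :=
    Real.exp_le_exp.2 (by linarith)
  rw [Real.exp_add, Real.exp_log (by positivity)] at h2
  have := exp_eulerMascheroniConstant_le
  linarith

theorem exp_one_le_one_add_exp_eulerMascheroniConstant :
    Real.exp 1 ≤ 1 + Real.exp Real.eulerMascheroniConstant := by
  simpa using exp_harmonic_le 1

theorem exp_le_chord (a b s : ℝ) (hs0 : 0 ≤ s) (hs1 : s ≤ 1) :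
    Real.exp ((1 - s) * a + s * b) ≤ (1 - s) * Real.exp a + s * Real.exp b := by
  simpa using convexOn_exp.2 (Set.mem_univ a) (Set.mem_univ b) (sub_nonneg.2 hs1) hs0 (by ring)

/-- Convexity of exp carries `exp_harmonic_le` from the integers m and m + 1 to the points between
them, with H interpolated linearly. -/
theorem exp_harmonic_add_le (m : ℕ) (s : ℝ) (hs0 : 0 ≤ s) (hs1 : s ≤ 1) :
    Real.exp (harmonic m + s / (m + 1))
      ≤ 1 + Real.exp Real.eulerMascheroniConstant * (m + s) := by
  have h := exp_le_chord (harmonic m) (harmonic (m + 1)) s hs0 hs1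
  have e : (1 - s) * (harmonic m : ℝ) + s * (harmonic (m + 1) : ℝ) = harmonic m + s / (m + 1) := by
    rw [harmonic_succ]; push_cast; field_simp; ring
  rw [e] at h
  have h1 := mul_le_mul_of_nonneg_left (exp_harmonic_le m) (sub_nonneg.2 hs1)
  have h2 := mul_le_mul_of_nonneg_left (exp_harmonic_le (m + 1)) hs0
  push_cast at h2
  linarith

/-- Concavity of the logarithm in chord form. -/
theorem log_ge_chord (a b s : ℝ) (ha : 0 < a) (hb : 0 < b) (hs0 : 0 ≤ s) (hs1 : s ≤ 1) :
    (1 - s) * Real.log a + s * Real.log b ≤ Real.log ((1 - s) * a + s * b) := by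
  simpa using strictConcaveOn_log_Ioi.concaveOn.2 ha hb (sub_nonneg.2 hs1) hs0 (by ring)

theorem exp_div_le (q d : ℝ) (hq : 0 < q) (hd0 : 0 ≤ d) (hd : d ≤ q) :
    Real.exp (d / q) ≤ 1 + Real.exp Real.eulerMascheroniConstant * (d / q) := by
  have h := exp_harmonic_add_le 0 (d / q) (by positivity) ((div_le_one hq).2 hd)
  simpa using h

theorem le_exp_eulerMascheroniConstant :
    (17 / 10 : ℝ) ≤ Real.exp Real.eulerMascheroniConstant := by
  have h1 := exp_one_le_one_add_exp_eulerMascheroniConstant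
  have h2 := Real.exp_one_gt_d9
  norm_num at h2
  linarith

/-- By `exp_div_le` it is enough that log q / q ≤ log 2 / 2. This is an equality at 2 and at 4, and
log x / x decreases beyond e, so only q = 3 fails and is checked numerically. -/
theorem exp_two_div_le (q : ℕ) (hq : 2 ≤ q) :
    Real.exp (2 / q) ≤ 1 + Real.exp Real.eulerMascheroniConstant * (Real.log 2 / Real.log q) := by
  have hq' : (2 : ℝ) ≤ q := by exact_mod_cast hq
  have hlq : 0 < Real.log q := Real.log_pos (by linarith)
  have hγ := le_exp_eulerMascheroniConstant
  rcases eq_or_ne q 3 with rfl | h3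
  · have h2 := Real.log_two_gt_d9
    have h3 := Real.log_three_lt_d9
    norm_num at h2 h3
    have hl : (63 / 100 : ℝ) ≤ Real.log 2 / Real.log (3 : ℕ) := by
      rw [le_div_iff₀ hlq]; norm_num; linarith
    have he : Real.exp (2 / (3 : ℕ)) ≤ 2 := by
      refine (Real.exp_bound' (n := 5) (by norm_num) (by norm_num) (by norm_num)).trans ?_
      simp only [Finset.sum_range_succ, Nat.factorial]
      norm_num
    nlinarith
  refine (exp_div_le q 2 (by linarith) (by norm_num) hq').trans ?_
  gcongr 1 + Real.exp Real.eulerMascheroniConstant * ?_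
  rw [div_le_div_iff₀ (by linarith) hlq]
  rcases eq_or_ne q 2 with rfl | h2
  · norm_num; linarith
  have h4 : (4 : ℝ) ≤ q := by
    have : 4 ≤ q := by omega
    exact_mod_cast this
  have hanti := Real.log_div_self_antitoneOn
    (show (4 : ℝ) ∈ {x | Real.exp 1 ≤ x} from by
      have := Real.exp_one_lt_d9; simp only [Set.mem_ofPred_eq]; norm_num at this ⊢; linarith)
    (show (q : ℝ) ∈ {x | Real.exp 1 ≤ x} from by
      have := Real.exp_one_lt_d9; simp only [Set.mem_ofPred_eq]; norm_num at this ⊢; linarith) h4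
  simp only at hanti
  rw [show (4 : ℝ) = 2 ^ 2 by norm_num, Real.log_pow, div_le_iff₀ (by linarith)] at hanti
  norm_num at hanti
  linarith

/-- The exponent is the bound of `IsPrimeSet.sum_invNorm_le` with only the last term q^m of its
geometric sum kept. On the given range the left side is convex in d and the right side concave, so
the end points decide. For m = 0 the range starts at d = 2, which is `exp_two_div_le`. -/
theorem exp_le_one_add_mul_log (q d m : ℕ) (hq : 2 ≤ q) (hd : 2 ≤ d)
    (h1 : q ^ m ≤ d) (h2 : d ≤ q ^ (m + 1)) :
    Real.exp (harmonic m + ((d : ℝ) - if m = 0 then 0 else (q : ℝ) ^ m) / ((m + 1) * q ^ (m + 1)))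
      ≤ 1 + Real.exp Real.eulerMascheroniConstant * (Real.log d / Real.log q) := by
  have hq' : (2 : ℝ) ≤ q := by exact_mod_cast hq
  have hd' : (2 : ℝ) ≤ d := by exact_mod_cast hd
  have hlq : 0 < Real.log q := Real.log_pos (by linarith)
  rcases Nat.eq_zero_or_pos m with rfl | hm
  · simp only [zero_add, pow_one] at h2
    have h2' : (d : ℝ) ≤ q := by exact_mod_cast h2
    simp only [harmonic_zero, Rat.cast_zero, if_true, sub_zero, zero_add, Nat.cast_zero, one_mul,
      pow_one]
    rcases eq_or_ne q 2 with rfl | hq2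
    · have : d = 2 := le_antisymm h2 hd
      subst this
      exact exp_two_div_le 2 le_rfl
    have hq3 : (2 : ℝ) < q := by
      have : 2 < q := by omega
      exact_mod_cast this
    set s : ℝ := (d - 2) / (q - 2) with hs
    have hs0 : 0 ≤ s := div_nonneg (by linarith) (by linarith)
    have hs1 : s ≤ 1 := (div_le_one (by linarith)).2 (by linarith)
    have hds : (d : ℝ) = (1 - s) * 2 + s * q := by
      have : q - 2 ≠ (0 : ℝ) := by linarith
      rw [hs]; field_simp; ring
    have hlog := log_ge_chord 2 q s (by norm_num) (by linarith) hs0 hs1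
    rw [← hds] at hlog
    have hexp := exp_le_chord (2 / q) 1 s hs0 hs1
    have e : (1 - s) * (2 / (q : ℝ)) + s * 1 = d / q := by
      rw [hds]; field_simp
    rw [e] at hexp
    have a1 := mul_le_mul_of_nonneg_left (exp_two_div_le q hq) (sub_nonneg.2 hs1)
    have a2 := mul_le_mul_of_nonneg_left exp_one_le_one_add_exp_eulerMascheroniConstant hs0
    have a3 : (1 - s) * (Real.log 2 / Real.log q) + s ≤ Real.log d / Real.log q := by
      rw [le_div_iff₀ hlq]
      have : ((1 - s) * (Real.log 2 / Real.log q) + s) * Real.log q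
        = (1 - s) * Real.log 2 + s * Real.log q := by field_simp
      rw [this]; exact hlog
    have a4 := mul_le_mul_of_nonneg_left a3 (Real.exp_pos Real.eulerMascheroniConstant).le
    linarith
  · rw [if_neg hm.ne']
    have h1' : (q : ℝ) ^ m ≤ d := by exact_mod_cast h1
    have h2' : (d : ℝ) ≤ q ^ (m + 1) := by exact_mod_cast h2
    have hqm : (0 : ℝ) < q ^ m := by positivity
    set s : ℝ := (d / q ^ m - 1) / (q - 1) with hs
    have hq1 : (0 : ℝ) < q - 1 := by linarith
    have hs0 : 0 ≤ s := div_nonneg (by rw [sub_nonneg, le_div_iff₀ hqm]; linarith) hq1.le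
    have hs1 : s ≤ 1 := by
      rw [hs, div_le_one hq1, sub_le_sub_iff_right, div_le_iff₀ hqm]
      rw [pow_succ] at h2'; linarith
    have hds : (d : ℝ) = q ^ m * ((1 - s) * 1 + s * q) := by
      rw [hs]; field_simp; ring
    have hlog := log_ge_chord 1 q s (by norm_num) (by linarith) hs0 hs1
    have hpos : 0 < (1 - s) * 1 + s * (q : ℝ) := by nlinarith
    have hlogd : m * Real.log q + s * Real.log q ≤ Real.log d := by
      rw [hds, Real.log_mul hqm.ne' hpos.ne', Real.log_pow]
      simp only [Real.log_one, mul_zero, zero_add] at hlog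
      linarith
    have hle : (m : ℝ) + s ≤ Real.log d / Real.log q := by
      rw [le_div_iff₀ hlq]; linarith
    have hx : ((d : ℝ) - q ^ m) / ((m + 1) * q ^ (m + 1)) ≤ s / (m + 1) := by
      have : (d : ℝ) - q ^ m = q ^ m * (s * (q - 1)) := by rw [hds]; ring
      rw [this, div_le_div_iff₀ (by positivity) (by positivity), pow_succ]
      have : 0 ≤ q ^ m * s * ((m : ℝ) + 1) := by positivity
      nlinarith
    refine (Real.exp_le_exp.2 (by linarith : _ ≤ (harmonic m : ℝ) + s / (m + 1))).trans ?_
    refine (exp_harmonic_add_le m s hs0 hs1).trans ?_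
    gcongr

/-! ### Abel sums of the logarithmic and linear bounds -/

/-- The degree factor `2 + i (i - 1) / 2` of `g (g - 1) ∏_{2 ≤ j ≤ i} (g ^ j - 1) / (g - 1)`. -/
def orderDegree (i : ℕ) : ℕ := 2 + i.choose 2

theorem orderDegree_cast (i : ℕ) : (orderDegree i : ℝ) = 2 + i * (i - 1) / 2 := by
  simp [orderDegree, Nat.cast_choose_two]

theorem two_le_orderDegree (i : ℕ) : 2 ≤ orderDegree i := by simp [orderDegree]

/-- The Abel-summation weights `1 / (i (i + 1))` for `i < X`, together with `1 / X` at `X`. -/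
noncomputable def abelSum (w : ℕ → ℝ) (X : ℕ) : ℝ :=
  ∑ i ∈ Finset.Ico 1 X, w i / (i * (i + 1)) + w X / X

theorem abelSum_mono {w v : ℕ → ℝ} (X : ℕ) (hX : 1 ≤ X) (h : ∀ i, 1 ≤ i → w i ≤ v i) :
    abelSum w X ≤ abelSum v X := by
  unfold abelSum
  gcongr with i hi
  · exact h i (Finset.mem_Ico.1 hi).1
  · exact h X hX

/-- The weights telescope to total mass 1. -/
theorem abelSum_const_add_mul (w : ℕ → ℝ) (c b : ℝ) (X : ℕ) (hX : 1 ≤ X) :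
    abelSum (fun i => c + b * w i) X = c + b * abelSum w X := by
  have h1 : ∀ X : ℕ, 1 ≤ X → ∑ i ∈ Finset.Ico 1 X, (1 : ℝ) / (i * (i + 1)) + 1 / X = 1 := by
    intro X hX
    induction X, hX using Nat.le_induction with
    | base => simp
    | succ n hn ih =>
      rw [Finset.sum_Ico_succ_top hn]
      have : (n : ℝ) ≠ 0 := by positivity
      have e : (1 : ℝ) / (n * (n + 1)) + 1 / ((n + 1 : ℕ) : ℝ) = 1 / n := by
        push_cast
        field_simp
        ring
      rw [add_assoc, e, ih]
  unfold abelSum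
  have h2 : ∑ i ∈ Finset.Ico 1 X, (c + b * w i) / ((i : ℝ) * (i + 1))
      = c * ∑ i ∈ Finset.Ico 1 X, (1 : ℝ) / (i * (i + 1))
        + b * ∑ i ∈ Finset.Ico 1 X, w i / (i * (i + 1)) := by
    rw [Finset.mul_sum, Finset.mul_sum, ← Finset.sum_add_distrib]
    exact Finset.sum_congr rfl fun i _ => by ring
  rw [h2]
  have := h1 X hX
  linear_combination c * this

theorem log_orderDegree_le (i : ℕ) (hi : 4 ≤ i) :
    Real.log (orderDegree i) ≤ 2 * Real.log i - Real.log 2 := by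
  have hi' : (4 : ℝ) ≤ i := by exact_mod_cast hi
  have h0 : (0 : ℝ) < orderDegree i := by
    have := two_le_orderDegree i; positivity
  rw [show 2 * Real.log i = Real.log ((i : ℝ) ^ 2) by rw [Real.log_pow]; norm_num,
    ← Real.log_div (by positivity) (by norm_num)]
  apply Real.log_le_log h0
  rw [orderDegree_cast]
  nlinarith

/-- For i ≥ 4, `log_orderDegree_le` bounds the numerator by 2 log i − log 2, and (2 log x + 2 − log
2)/x is minus an antiderivative of (2 log x − log 2)/x². The induction telescopes this; the term
subtracted at X leaves room for the boundary term of `abelSum`. -/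
theorem sum_log_orderDegree_le (X : ℕ) (hX : 4 ≤ X) :
    ∑ i ∈ Finset.Ico 1 X, Real.log (orderDegree i) / (i * (i + 1))
      ≤ Real.log 6 - (2 * Real.log X + 2 - Real.log 2) / X := by
  induction X, hX using Nat.le_induction with
  | base =>
    have e1 : (orderDegree 1 : ℝ) = 2 := by rw [orderDegree_cast]; norm_num
    have e2 : (orderDegree 2 : ℝ) = 3 := by rw [orderDegree_cast]; norm_num
    have e3 : (orderDegree 3 : ℝ) = 5 := by rw [orderDegree_cast]; norm_num
    rw [show Finset.Ico 1 4 = {1, 2, 3} by rfl]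
    simp only [Finset.mem_insert, Finset.mem_singleton, OfNat.one_ne_ofNat, or_self,
      not_false_eq_true, Finset.sum_insert, Finset.sum_singleton, e1, e2, e3, Nat.reduceEqDiff]
    rw [show (6 : ℝ) = 2 * 3 by norm_num, Real.log_mul (by norm_num) (by norm_num)]
    have h4 : Real.log (4 : ℕ) = 2 * Real.log 2 := by
      rw [show ((4 : ℕ) : ℝ) = 2 ^ 2 by norm_num, Real.log_pow]; norm_num
    rw [h4]
    have := Real.log_two_lt_d9
    have := Real.log_three_gt_d9
    have := Real.log_five_lt_d9
    norm_num at *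
    linarith
  | succ n hn ih =>
    rw [Finset.sum_Ico_succ_top (by omega)]
    have hn' : (4 : ℝ) ≤ n := by exact_mod_cast hn
    have hlog : Real.log (n + 1) - Real.log n ≤ 1 / n := by
      rw [← Real.log_div (by positivity) (by positivity)]
      refine (Real.log_le_sub_one_of_pos (by positivity)).trans (le_of_eq ?_)
      field_simp
      ring
    have key : Real.log (orderDegree n) / (n * (n + 1))
        ≤ (2 * Real.log n + 2 - Real.log 2) / n
          - (2 * Real.log (n + 1) + 2 - Real.log 2) / (n + 1) := by
      rw [div_sub_div _ _ (by positivity) (by positivity)]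
      refine div_le_div_of_nonneg_right ?_ (by positivity)
      have h1 := log_orderDegree_le n hn
      have h2 := mul_le_mul_of_nonneg_left hlog (by positivity : (0 : ℝ) ≤ 2 * n)
      have h3 : 2 * (n : ℝ) * (1 / n) = 2 := by field_simp
      rw [h3] at h2
      linarith
    push_cast
    linarith

theorem abelSum_log_orderDegree_le (X : ℕ) (hX : 1 ≤ X) :
    abelSum (fun i => Real.log (orderDegree i)) X ≤ Real.log 6 := by
  rcases le_or_gt 4 X with h4 | h4
  · have h1 := sum_log_orderDegree_le X h4
    have h2 := log_orderDegree_le X h4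
    have hX' : (0 : ℝ) < X := by positivity
    have h3 : Real.log (orderDegree X) / X ≤ (2 * Real.log X + 2 - Real.log 2) / X :=
      div_le_div_of_nonneg_right (by linarith) hX'.le
    simp only [abelSum]
    linarith
  · have e1 : (orderDegree 1 : ℝ) = 2 := by rw [orderDegree_cast]; norm_num
    have e2 : (orderDegree 2 : ℝ) = 3 := by rw [orderDegree_cast]; norm_num
    have e3 : (orderDegree 3 : ℝ) = 5 := by rw [orderDegree_cast]; norm_num
    rw [show (6 : ℝ) = 2 * 3 by norm_num, Real.log_mul (by norm_num) (by norm_num)]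
    have := Real.log_two_lt_d9
    have := Real.log_two_gt_d9
    have := Real.log_three_gt_d9
    have := Real.log_five_lt_d9
    interval_cases X
    · simp only [abelSum, Finset.Ico_self, Finset.sum_empty, e1]
      norm_num at *
      linarith
    · rw [abelSum, show Finset.Ico 1 2 = {1} by rfl]
      simp only [Finset.sum_singleton, e1, e2]
      norm_num at *
      linarith
    · rw [abelSum, show Finset.Ico 1 3 = {1, 2} by rfl]
      simp only [Finset.mem_singleton, OfNat.one_ne_ofNat,
        not_false_eq_true, Finset.sum_insert, Finset.sum_singleton, e1, e2, e3]
      norm_num at *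
      linarith

theorem orderDegree_le_mul (i : ℕ) (hi : 1 ≤ i) : (orderDegree i : ℝ) ≤ i * (i + 1) := by
  have hi' : (1 : ℝ) ≤ i := by exact_mod_cast hi
  rw [orderDegree_cast]; nlinarith

theorem orderDegree_le_sq (i : ℕ) (hi : 2 ≤ i) : (orderDegree i : ℝ) ≤ i ^ 2 := by
  have hi' : (2 : ℝ) ≤ i := by exact_mod_cast hi
  rw [orderDegree_cast]; nlinarith

theorem sqrt_div_le (i : ℕ) (hi : 1 ≤ i) :
    √(i : ℝ) / (i * (i + 1)) ≤ 2 / √(i : ℝ) - 2 / √((i : ℝ) + 1) := by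
  have hi' : (1 : ℝ) ≤ i := by exact_mod_cast hi
  set a := √(i : ℝ) with ha
  set b := √((i : ℝ) + 1) with hb
  have ha0 : 0 < a := Real.sqrt_pos.2 (by linarith)
  have hb0 : 0 < b := Real.sqrt_pos.2 (by linarith)
  have ha2 : a ^ 2 = i := Real.sq_sqrt (by linarith)
  have hb2 : b ^ 2 = i + 1 := Real.sq_sqrt (by linarith)
  have hab : a ≤ b := Real.sqrt_le_sqrt (by linarith)
  rw [← hb2, ← ha2, div_sub_div _ _ ha0.ne' hb0.ne', div_le_div_iff₀ (by positivity) (by positivity)]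
  have h1 : (b - a) * (b + a) = 1 := by linear_combination hb2 - ha2
  have h2 : 1 ≤ (b - a) * (2 * b) := by
    rw [← h1]; exact mul_le_mul_of_nonneg_left (by linarith) (by linarith)
  have h3 : 0 ≤ a ^ 2 * b := by positivity
  nlinarith [mul_le_mul_of_nonneg_left h2 h3]

theorem sum_sqrt_div_le (Y X : ℕ) (hY : 1 ≤ Y) (hYX : Y ≤ X) :
    ∑ i ∈ Finset.Ico Y X, √(i : ℝ) / (i * (i + 1)) ≤ 2 / √(Y : ℝ) - 2 / √(X : ℝ) := by
  induction X, hYX using Nat.le_induction with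
  | base => simp
  | succ n hn ih =>
    rw [Finset.sum_Ico_succ_top hn]
    have := sqrt_div_le n (hY.trans hn)
    push_cast
    linarith

/-- The square-root bound, in the range where it is the smaller of the two. -/
theorem abelSum_le_sqrt (q τ : ℝ) (hq : 25 < q) (hτ0 : 0 < τ) (hτ : τ < 1 / 25) (w : ℕ → ℝ)
    (h1 : ∀ i, 1 ≤ i → w i ≤ τ * orderDegree i)
    (h2 : ∀ i, 1 ≤ i → w i ≤ 1 + Real.log (τ * orderDegree i) / Real.log q)
    (X : ℕ) (hX : 1 ≤ X) : abelSum w X ≤ 5 * √τ := by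
  set σ := √τ with hσ
  have hσ0 : 0 < σ := Real.sqrt_pos.2 hτ0
  have hσ2 : σ ^ 2 = τ := Real.sq_sqrt hτ0.le
  have hσ5 : σ < 1 / 5 := by nlinarith
  have hlq : 3 ≤ Real.log q := by
    rw [Real.le_log_iff_exp_le (by linarith)]
    have h := Real.exp_one_lt_d9
    have h3 : Real.exp 3 = Real.exp 1 ^ 3 := by rw [← Real.exp_nat_mul]; norm_num
    rw [h3]
    have : Real.exp 1 ^ 3 ≤ (2.7182818286 : ℝ) ^ 3 := pow_le_pow_left₀ (Real.exp_pos 1).le h.le 3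
    norm_num at this
    linarith
  -- τ i² = (σ i)² reaches 1 at i = 1/σ. The linear bound is used before that point, where each term
  -- is at most τ, and the logarithmic bound after it.
  set Y := ⌈1 / σ⌉₊ with hY
  have hY1 : 1 / σ ≤ Y := Nat.le_ceil _
  have hY2 : (Y : ℝ) < 1 / σ + 1 := Nat.ceil_lt_add_one (by positivity)
  have hσY : 1 ≤ σ * Y := by rw [div_le_iff₀ hσ0] at hY1; linarith
  have hY0 : (0 : ℝ) < Y := by
    by_contra h
    have : (Y : ℝ) = 0 := le_antisymm (not_lt.1 h) (Nat.cast_nonneg _)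
    rw [this] at hσY; linarith
  have hY5 : 5 ≤ Y := by
    have : (5 : ℝ) < Y := by
      have : 5 < 1 / σ := by rw [lt_div_iff₀ hσ0]; linarith
      linarith
    exact_mod_cast this.le
  have hσY' : σ * (Y - 1) ≤ 1 := by
    have : (Y : ℝ) - 1 ≤ 1 / σ := by linarith
    rw [le_div_iff₀ hσ0] at this; linarith
  have head : ∀ Z : ℕ, 1 ≤ Z → ∑ i ∈ Finset.Ico 1 Z, w i / (i * (i + 1)) ≤ τ * (Z - 1) := by
    intro Z hZ
    have : ∑ i ∈ Finset.Ico 1 Z, w i / ((i : ℝ) * (i + 1)) ≤ ∑ i ∈ Finset.Ico 1 Z, τ := by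
      refine Finset.sum_le_sum fun i hi => ?_
      have hi1 := (Finset.mem_Ico.1 hi).1
      have hi' : (1 : ℝ) ≤ i := by exact_mod_cast hi1
      rw [div_le_iff₀ (by positivity)]
      exact (h1 i hi1).trans (mul_le_mul_of_nonneg_left (orderDegree_le_mul i hi1) hτ0.le)
    refine this.trans (le_of_eq ?_)
    rw [Finset.sum_const, Nat.card_Ico, nsmul_eq_mul, Nat.cast_sub hZ]
    push_cast; ring
  rcases lt_or_ge X Y with hXY | hXY
  · have hh := head X hX
    have hX' : (1 : ℝ) ≤ X := by exact_mod_cast hX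
    have hl : w X / X ≤ τ * (X + 1) := by
      rw [div_le_iff₀ (by linarith)]
      have := (h1 X hX).trans (mul_le_mul_of_nonneg_left (orderDegree_le_mul X hX) hτ0.le)
      linarith
    have hXY' : (X : ℝ) ≤ Y - 1 := by
      have : (X : ℝ) + 1 ≤ Y := by exact_mod_cast hXY
      linarith
    have : τ * X ≤ σ := by
      rw [← hσ2]
      nlinarith [mul_le_mul_of_nonneg_left hXY' hσ0.le]
    unfold abelSum
    linarith
  -- With z = √(σ i) ≥ 1, τ times the degree factor is at most z⁴, and log q ≥ 3 gives w i ≤ 1 + 4(z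
  -- − 1)/3 ≤ 4z/3.
  · have hw : ∀ i, Y ≤ i → w i ≤ 4 / 3 * (√σ * √(i : ℝ)) := by
      intro i hi
      have hi1 : 1 ≤ i := by omega
      have hi' : (Y : ℝ) ≤ i := by exact_mod_cast hi
      have hz : 1 ≤ σ * i := hσY.trans (mul_le_mul_of_nonneg_left hi' hσ0.le)
      rw [← Real.sqrt_mul hσ0.le]
      set z := √(σ * i) with hz'
      have hz0 : 1 ≤ z := Real.one_le_sqrt.2 hz
      have hz2 : z ^ 2 = σ * i := Real.sq_sqrt (by linarith)
      refine (h2 i hi1).trans ?_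
      have hs0 : (0 : ℝ) < orderDegree i := by
        have := two_le_orderDegree i; positivity
      have hlog : Real.log (τ * orderDegree i) ≤ 4 * Real.log z := by
        have : Real.log (z ^ 4) = 4 * Real.log z := by rw [Real.log_pow]; norm_num
        rw [← this]
        apply Real.log_le_log (by positivity)
        have e : z ^ 4 = τ * (i : ℝ) ^ 2 := by
          rw [← hσ2, show z ^ 4 = (z ^ 2) ^ 2 by ring, hz2]; ring
        rw [e]
        exact mul_le_mul_of_nonneg_left (orderDegree_le_sq i (by omega)) hτ0.le
      have hlz := Real.log_le_sub_one_of_pos (by linarith : 0 < z)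
      have : Real.log (τ * orderDegree i) / Real.log q ≤ 4 * (z - 1) / 3 := by
        rw [div_le_div_iff₀ (by linarith) (by norm_num)]
        have h5 : 0 ≤ z - 1 := by linarith
        nlinarith
      linarith
    have hsum : ∑ i ∈ Finset.Ico Y X, w i / ((i : ℝ) * (i + 1))
        ≤ 4 / 3 * √σ * (2 / √(Y : ℝ) - 2 / √(X : ℝ)) := by
      refine le_trans ?_ (mul_le_mul_of_nonneg_left (sum_sqrt_div_le Y X (by omega) hXY)
        (by positivity))
      rw [Finset.mul_sum]
      refine Finset.sum_le_sum fun i hi => ?_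
      rw [← mul_div_assoc]
      refine div_le_div_of_nonneg_right ?_ (by positivity)
      have := hw i (Finset.mem_Ico.1 hi).1
      linarith
    have hX0 : (0 : ℝ) < X := by positivity
    have hlast : w X / X ≤ 4 / 3 * √σ * (1 / √(X : ℝ)) := by
      rw [div_le_iff₀ hX0]
      refine (hw X hXY).trans (le_of_eq ?_)
      have : √(X : ℝ) ≠ 0 := (Real.sqrt_pos.2 hX0).ne'
      nth_rewrite 3 [← Real.sq_sqrt hX0.le]
      field_simp
    have hsX : 0 ≤ 4 / 3 * √σ * (1 / √(X : ℝ)) := by positivity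
    have hsY : √σ / √(Y : ℝ) ≤ σ := by
      rw [div_le_iff₀ (Real.sqrt_pos.2 hY0)]
      have h1' : 1 ≤ √σ * √(Y : ℝ) := by
        rw [← Real.sqrt_mul hσ0.le]; exact Real.one_le_sqrt.2 hσY
      have := mul_le_mul_of_nonneg_left h1' (Real.sqrt_nonneg σ)
      rwa [mul_one, ← mul_assoc, Real.mul_self_sqrt hσ0.le] at this
    have hhead := head Y (by omega)
    have : τ * (Y - 1) ≤ σ := by
      rw [← hσ2]
      nlinarith [mul_le_mul_of_nonneg_left hσY' hσ0.le]
    unfold abelSum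
    rw [← Finset.sum_Ico_consecutive _ (by omega : 1 ≤ Y) hXY]
    -- The boundary term at X is absorbed by the telescoped term at X; the total is at most σ +
    -- 8σ/3.
    have e : 4 / 3 * √σ * (2 / √(Y : ℝ) - 2 / √(X : ℝ))
      = 8 / 3 * (√σ / √(Y : ℝ)) - 2 * (4 / 3 * √σ * (1 / √(X : ℝ))) := by ring
    rw [e] at hsum
    linarith

/-- For τ = δ/q the left side is log(6δ)/log q, so from τ = 1/25 on the logarithmic bound alone
implies the square-root bound. -/
theorem log_six_mul_div_log_le (q τ : ℝ) (hq : 2 ≤ q) (hτ : 1 / 25 ≤ τ) :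
    1 + Real.log (6 * τ) / Real.log q ≤ 5 * √τ := by
  have hlq : 0 < Real.log q := Real.log_pos (by linarith)
  have hσ2 : √τ ^ 2 = τ := Real.sq_sqrt (by linarith)
  have hσ : 1 / 5 ≤ √τ := Real.le_sqrt_of_sq_le (by linarith)
  rcases le_or_gt (6 * τ) 1 with h | h
  · have : Real.log (6 * τ) / Real.log q ≤ 0 :=
      div_nonpos_of_nonpos_of_nonneg (Real.log_nonpos (by linarith) h) hlq.le
    linarith
  · set y := √(6 * τ) with hy
    have hy2 : y ^ 2 = 6 * τ := Real.sq_sqrt (by linarith)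
    have hy1 : 1 ≤ y := Real.one_le_sqrt.2 h.le
    have hlog : Real.log (6 * τ) = 2 * Real.log y := by rw [← hy2, Real.log_pow]; norm_num
    have hl2 : Real.log 2 ≤ Real.log q := Real.log_le_log (by norm_num) hq
    have a1 := Real.log_two_gt_d9
    have a2 := Real.log_two_lt_d9
    norm_num at a1 a2
    -- Tangent line of log at 2. The target then becomes 2y ≤ 5√τ, true because 4 · 6 ≤ 25.
    have hly : Real.log y ≤ y / 2 - 1 + Real.log 2 := by
      have := Real.log_le_sub_one_of_pos (by linarith : 0 < y / 2)
      rw [Real.log_div (by linarith) (by norm_num)] at this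
      linarith
    have hlq' : Real.log (6 * τ) / Real.log q ≤ 2 + (y - 2) / Real.log 2 := by
      rw [hlog]
      have h0 : 0 ≤ Real.log y := Real.log_nonneg hy1
      have : 2 * Real.log y / Real.log q ≤ 2 * Real.log y / Real.log 2 :=
        div_le_div_of_nonneg_left (by linarith) (by linarith) hl2
      refine this.trans ?_
      rw [div_le_iff₀ (by linarith)]
      have : (2 + (y - 2) / Real.log 2) * Real.log 2 = 2 * Real.log 2 + (y - 2) := by
        have : Real.log 2 ≠ 0 := by linarith
        field_simp
      rw [this]; linarith
    have h5 : 2 * y ≤ 5 * √τ := by nlinarith [Real.sqrt_nonneg τ]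
    have h6 : (y - 2) / Real.log 2 ≤ 2 * y - 3 := by
      rw [div_le_iff₀ (by linarith)]
      nlinarith
    linarith

theorem abelSum_le_min (q δ : ℕ) (hq : 2 ≤ q) (hδ : 1 ≤ δ) (E : ℕ → ℝ)
    (h1 : ∀ i, 1 ≤ i → E i ≤ 1 + Real.exp Real.eulerMascheroniConstant *
      (Real.log (δ * orderDegree i : ℕ) / Real.log q))
    (h2 : ∀ i, 1 ≤ i → δ * orderDegree i ≤ q →
      E i ≤ 1 + Real.exp Real.eulerMascheroniConstant * ((δ * orderDegree i : ℕ) / q))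
    (X : ℕ) (hX : 1 ≤ X) :
    abelSum E X ≤ 1 + Real.exp Real.eulerMascheroniConstant *
      min (5 * √((δ : ℝ) / q)) (Real.log (6 * (δ : ℝ)) / Real.log q) := by
  have hq' : (2 : ℝ) ≤ q := by exact_mod_cast hq
  have hδ' : (1 : ℝ) ≤ δ := by exact_mod_cast hδ
  have hlq : 0 < Real.log q := Real.log_pos (by linarith)
  have hs : ∀ i, (0 : ℝ) < orderDegree i := fun i => by
    have := two_le_orderDegree i; positivity
  have hγ := Real.exp_pos Real.eulerMascheroniConstant
  have second : abelSum (fun i => Real.log (δ * orderDegree i : ℕ) / Real.log q) X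
      ≤ Real.log (6 * (δ : ℝ)) / Real.log q := by
    have e : (fun i => Real.log (δ * orderDegree i : ℕ) / Real.log q)
        = fun i => Real.log δ / Real.log q + 1 / Real.log q * Real.log (orderDegree i) := by
      funext i
      push_cast
      rw [Real.log_mul (by linarith) (hs i).ne']
      ring
    rw [e, abelSum_const_add_mul _ _ _ X hX, Real.log_mul (by norm_num) (by linarith), add_div,
      add_comm, one_div_mul_eq_div]
    gcongr
    exact abelSum_log_orderDegree_le X hX
  have key : ∀ w : ℕ → ℝ, (∀ i, 1 ≤ i → E i ≤ 1 + Real.exp Real.eulerMascheroniConstant * w i) →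
      abelSum E X ≤ 1 + Real.exp Real.eulerMascheroniConstant * abelSum w X := by
    intro w hw
    rw [← abelSum_const_add_mul w _ _ X hX]
    exact abelSum_mono X hX hw
  rcases min_cases (5 * √((δ : ℝ) / q)) (Real.log (6 * (δ : ℝ)) / Real.log q) with hm | hm
  swap
  · rw [hm.1]
    exact (key _ h1).trans (by gcongr)
  rw [hm.1]
  rcases le_or_gt (1 / 25) ((δ : ℝ) / q) with hτ | hτ
  · have h3 := log_six_mul_div_log_le q (δ / q) hq' hτ
    have e : 1 + Real.log (6 * ((δ : ℝ) / q)) / Real.log q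
        = Real.log (6 * (δ : ℝ)) / Real.log q := by
      rw [← mul_div_assoc, Real.log_div (by positivity) (by positivity)]
      field_simp
      ring
    rw [e] at h3
    refine (key _ h1).trans ?_
    gcongr
    exact second.trans h3
  · have hq25 : (25 : ℝ) < q := by
      rw [div_lt_iff₀ (by linarith)] at hτ; linarith
    have hτ0 : (0 : ℝ) < δ / q := by positivity
    have hlog : ∀ i, Real.log (δ * orderDegree i : ℕ) / Real.log q
        = 1 + Real.log ((δ : ℝ) / q * orderDegree i) / Real.log q := by
      intro i
      have e : (δ : ℝ) / q * orderDegree i = (δ * orderDegree i : ℕ) / q := by push_cast; ring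
      have : ((δ * orderDegree i : ℕ) : ℝ) ≠ 0 := by
        have := hs i
        push_cast; positivity
      rw [e, Real.log_div this (by positivity)]
      field_simp
      ring
    have hlq1 : 1 ≤ Real.log q := by
      rw [Real.le_log_iff_exp_le (by linarith)]
      have := Real.exp_one_lt_d9
      norm_num at this
      linarith
    refine (key (fun i => min ((δ : ℝ) / q * orderDegree i)
      (Real.log (δ * orderDegree i : ℕ) / Real.log q)) ?_).trans ?_
    · intro i hi
      rcases min_cases ((δ : ℝ) / q * orderDegree i)
        (Real.log (δ * orderDegree i : ℕ) / Real.log q) with hm' | hm'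
      swap
      · rw [hm'.1]; exact h1 i hi
      rw [hm'.1]
      rcases le_or_gt (δ * orderDegree i) q with hle | hgt
      · refine (h2 i hi hle).trans (le_of_eq ?_)
        push_cast; ring
      -- Here t = δ · orderDegree i / q ≥ 1, and 1 + log t / log q ≤ t: beyond q the logarithmic
      -- bound implies the linear one.
      · refine (h1 i hi).trans ?_
        gcongr
        rw [hlog]
        have ht : 1 ≤ (δ : ℝ) / q * orderDegree i := by
          rw [div_mul_eq_mul_div, le_div_iff₀ (by linarith)]
          have : (q : ℝ) ≤ δ * orderDegree i := by exact_mod_cast hgt.le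
          linarith
        have hl0 := Real.log_nonneg ht
        have := Real.log_le_sub_one_of_pos (by linarith : 0 < (δ : ℝ) / q * orderDegree i)
        have : Real.log ((δ : ℝ) / q * orderDegree i) / Real.log q
          ≤ Real.log ((δ : ℝ) / q * orderDegree i) := div_le_self hl0 hlq1
        linarith
    · gcongr
      refine abelSum_le_sqrt q _ hq25 hτ0 hτ _ (fun i _ => min_le_left _ _) (fun i _ => ?_) X hX
      rw [← hlog]
      exact min_le_right _ _

/-! ### Monic polynomials and the count of irreducibles -/

open Polynomial in
/-- The monic polynomial of degree `n` with given lower coefficients. -/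
noncomputable def monicOfCoeffs {F : Type*} [Field F] (n : ℕ) (v : Fin n → F) : F[X] :=
  X ^ n + ((degreeLTEquiv F n).symm v : F[X])

theorem monicOfCoeffs_injective {F : Type*} [Field F] (n : ℕ) :
    Function.Injective (monicOfCoeffs (F := F) n) := fun _ _ h =>
  (Polynomial.degreeLTEquiv F n).symm.injective (Subtype.ext (add_left_cancel h))

/-- The monic polynomials of degree `n` over a finite field. -/
noncomputable def monicPolys (F : Type*) [Field F] [Fintype F] (n : ℕ) : Finset F[X] :=
  Finset.univ.map ⟨monicOfCoeffs n, monicOfCoeffs_injective n⟩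

open Polynomial in
theorem mem_monicPolys {F : Type*} [Field F] [Fintype F] {n : ℕ} {f : F[X]} :
    f ∈ monicPolys F n ↔ f.Monic ∧ f.natDegree = n := by
  simp only [monicPolys, Finset.mem_map, Finset.mem_univ, true_and, Function.Embedding.coeFn_mk]
  constructor
  · rintro ⟨v, rfl⟩
    have h := mem_degreeLT.1 ((degreeLTEquiv F n).symm v).2
    exact ⟨monic_X_pow_add h, by
      rw [monicOfCoeffs, natDegree_add_eq_left_of_degree_lt (by rwa [degree_X_pow]), natDegree_X_pow]⟩
  · rintro ⟨hf, rfl⟩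
    have h : f - X ^ f.natDegree ∈ degreeLT F f.natDegree := by
      rw [mem_degreeLT]
      by_cases h0 : f - X ^ f.natDegree = 0
      · rw [h0, degree_zero]; exact WithBot.bot_lt_coe _
      have hd : degree f = f.natDegree := degree_eq_natDegree hf.ne_zero
      have := degree_sub_lt_left (p := f) (q := X ^ f.natDegree) (by rw [degree_X_pow, hd])
        hf.ne_zero (by rw [hf.leadingCoeff, leadingCoeff_X_pow])
      rwa [hd] at this
    refine ⟨degreeLTEquiv F _ ⟨_, h⟩, ?_⟩
    rw [monicOfCoeffs, LinearEquiv.symm_apply_apply]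
    ring

theorem card_monicPolys (F : Type*) [Field F] [Fintype F] (n : ℕ) :
    (monicPolys F n).card = Fintype.card F ^ n := by
  simp [monicPolys]

open Classical in
/-- The monic irreducible polynomials of degree `n` over a finite field. -/
noncomputable def monicIrreducibles (F : Type*) [Field F] [Fintype F] (n : ℕ) : Finset F[X] :=
  (monicPolys F n).filter Irreducible

theorem mem_monicIrreducibles {F : Type*} [Field F] [Fintype F] {n : ℕ} {f : F[X]} :
    f ∈ monicIrreducibles F n ↔ f.Monic ∧ f.natDegree = n ∧ Irreducible f := by
  simp [monicIrreducibles, mem_monicPolys, and_assoc]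

/-- Sets of monic irreducible polynomials. -/
def IsPrimeSet {F : Type*} [Field F] (S : Finset F[X]) : Prop :=
  ∀ P ∈ S, P.Monic ∧ Irreducible P

theorem IsPrimeSet.mono {F : Type*} [Field F] {S T : Finset F[X]} (hT : IsPrimeSet T)
    (h : S ⊆ T) : IsPrimeSet S := fun P hP => hT P (h hP)

theorem IsPrimeSet.eq_of_dvd {F : Type*} [Field F] {S : Finset F[X]} (hS : IsPrimeSet S)
    {P Q : F[X]} (hP : P ∈ S) (hQ : Q ∈ S) (h : P ∣ Q) : P = Q :=
  Polynomial.eq_of_monic_of_associated (hS P hP).1 (hS Q hQ).1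
    ((hS P hP).2.associated_of_dvd (hS Q hQ).2 h)

theorem IsPrimeSet.isCoprime {F : Type*} [Field F] {S : Finset F[X]} (hS : IsPrimeSet S)
    {P Q : F[X]} (hP : P ∈ S) (hQ : Q ∈ S) (h : P ≠ Q) : IsCoprime P Q :=
  ((hS P hP).2.coprime_iff_not_dvd).2 fun hd => h (hS.eq_of_dvd hP hQ hd)

theorem IsPrimeSet.natDegree_prod {F : Type*} [Field F] {S : Finset F[X]} (hS : IsPrimeSet S) :
    (∏ P ∈ S, P).natDegree = ∑ P ∈ S, P.natDegree :=
  Polynomial.natDegree_prod _ _ fun P hP => (hS P hP).2.ne_zero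

theorem IsPrimeSet.prod_dvd {F : Type*} [Field F] {S : Finset F[X]} (hS : IsPrimeSet S)
    {G : F[X]} (hG : ∀ P ∈ S, P ∣ G) : ∏ P ∈ S, P ∣ G :=
  Finset.prod_dvd_of_coprime (fun _ hP _ hQ h => hS.isCoprime hP hQ h) hG

theorem IsPrimeSet.sum_natDegree_le {F : Type*} [Field F] {S : Finset F[X]} (hS : IsPrimeSet S)
    {G : F[X]} (hG0 : G ≠ 0) (hG : ∀ P ∈ S, P ∣ G) : ∑ P ∈ S, P.natDegree ≤ G.natDegree := by
  rw [← hS.natDegree_prod]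
  exact Polynomial.natDegree_le_of_dvd (hS.prod_dvd hG) hG0

open Classical in
/-- The monic irreducible factors of a polynomial. -/
noncomputable def primeDivisors {F : Type*} [Field F] (G : F[X]) : Finset F[X] :=
  (UniqueFactorizationMonoid.normalizedFactors G).toFinset

open Classical in
theorem monic_of_mem_normalizedFactors {F : Type*} [Field F] {G P : F[X]}
    (h : P ∈ UniqueFactorizationMonoid.normalizedFactors G) : P.Monic := by
  have hP := (UniqueFactorizationMonoid.irreducible_of_normalized_factor P h).ne_zero
  rw [← Polynomial.normalize_eq_self_iff_monic hP]
  exact UniqueFactorizationMonoid.normalize_normalized_factor P h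

open UniqueFactorizationMonoid in
theorem mem_primeDivisors {F : Type*} [Field F] {G P : F[X]} (hG : G ≠ 0) :
    P ∈ primeDivisors G ↔ P.Monic ∧ Irreducible P ∧ P ∣ G := by
  classical
  rw [primeDivisors, Multiset.mem_toFinset]
  constructor
  · intro h
    exact ⟨monic_of_mem_normalizedFactors h, irreducible_of_normalized_factor _ h,
      dvd_of_mem_normalizedFactors h⟩
  · rintro ⟨h1, h2, h3⟩
    obtain ⟨Q, hQ, hPQ⟩ := exists_mem_normalizedFactors_of_dvd hG h2 h3
    rwa [Polynomial.eq_of_monic_of_associated h1 (monic_of_mem_normalizedFactors hQ) hPQ]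

theorem isPrimeSet_primeDivisors {F : Type*} [Field F] {G : F[X]} (hG : G ≠ 0) :
    IsPrimeSet (primeDivisors G) := fun P hP => by
  rw [mem_primeDivisors hG] at hP; exact ⟨hP.1, hP.2.1⟩

open UniqueFactorizationMonoid in
theorem sum_natDegree_primeDivisors {F : Type*} [Field F] {G : F[X]} (hG : G ≠ 0)
    (hsq : Squarefree G) : ∑ P ∈ primeDivisors G, P.natDegree = G.natDegree := by
  classical
  have hnd : (normalizedFactors G).Nodup := (squarefree_iff_nodup_normalizedFactors hG).1 hsq
  have h1 : Associated (∏ P ∈ primeDivisors G, P) G := by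
    refine Associated.trans ?_ (prod_normalizedFactors hG)
    rw [primeDivisors, Finset.prod, Multiset.map_id', Multiset.toFinset_val, hnd.dedup]
  rw [← (isPrimeSet_primeDivisors hG).natDegree_prod]
  exact Polynomial.natDegree_eq_of_degree_eq (Polynomial.degree_eq_degree_of_associated h1)

-- X^(q^n) − X is separable and its monic irreducible factors are exactly those of degree dividing
-- n; compare degrees.
open Polynomial in
theorem sum_divisors_mul_card_monicIrreducibles (F : Type*) [Field F] [Fintype F] (n : ℕ)
    (hn : n ≠ 0) :
    ∑ d ∈ n.divisors, d * (monicIrreducibles F d).card = Fintype.card F ^ n := by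
  classical
  have hq : 1 < Fintype.card F := Fintype.one_lt_card
  set G : F[X] := X ^ Fintype.card F ^ n - X with hGdef
  have hG0 : G ≠ 0 := FiniteField.X_pow_card_pow_sub_X_ne_zero F hn hq
  have hGd : G.natDegree = Fintype.card F ^ n :=
    FiniteField.X_pow_card_pow_sub_X_natDegree_eq F hn hq
  have hsep : G.Separable := by
    obtain ⟨p, hp⟩ := CharP.exists F
    obtain ⟨k, hpp, hk⟩ := FiniteField.card F p
    refine galois_poly_separable p _ ?_
    rw [hk, ← pow_mul]
    exact dvd_pow_self p (by simp [hn])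
  rw [← hGd, ← sum_natDegree_primeDivisors hG0 hsep.squarefree]
  have hmem : ∀ P : F[X], P ∈ primeDivisors G ↔ P.Monic ∧ Irreducible P ∧ P.natDegree ∣ n := by
    intro P
    rw [mem_primeDivisors hG0]
    refine and_congr_right fun _ => and_congr_right fun hP => ?_
    rw [hP.natDegree_dvd_iff_dvd_X_pow_card_pow_sub_X, hGdef, Nat.card_eq_fintype_card]
  rw [← Finset.sum_fiberwise_of_maps_to (s := primeDivisors G) (t := n.divisors)
    (g := fun P => P.natDegree)
    (fun P hP => Nat.mem_divisors.2 ⟨((hmem P).1 hP).2.2, hn⟩)]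
  refine Finset.sum_congr rfl fun d hd => ?_
  have e : (primeDivisors G).filter (fun P => P.natDegree = d) = monicIrreducibles F d := by
    ext P
    rw [Finset.mem_filter, hmem, mem_monicIrreducibles]
    constructor
    · rintro ⟨⟨a, b, -⟩, rfl⟩; exact ⟨a, rfl, b⟩
    · rintro ⟨a, rfl, b⟩; exact ⟨⟨a, b, Nat.dvd_of_mem_divisors hd⟩, rfl⟩
  rw [e, Finset.sum_congr rfl fun P hP => (mem_monicIrreducibles.1 hP).2.1, Finset.sum_const,
    smul_eq_mul, mul_comm]

theorem mul_card_monicIrreducibles_le (F : Type*) [Field F] [Fintype F] (n : ℕ) :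
    n * (monicIrreducibles F n).card ≤ Fintype.card F ^ n := by
  rcases eq_or_ne n 0 with rfl | hn
  · simp
  rw [← sum_divisors_mul_card_monicIrreducibles F n hn]
  exact Finset.single_le_sum (f := fun d => d * (monicIrreducibles F d).card)
    (fun _ _ => Nat.zero_le _) (Nat.mem_divisors_self n hn)

theorem sum_range_pow_succ_lt (q m : ℕ) (hq : 2 ≤ q) :
    ∑ d ∈ Finset.range m, q ^ (d + 1) < 2 * q ^ m := by
  induction m with
  | zero => simp
  | succ m ih =>
    rw [Finset.sum_range_succ]
    have : 2 * q ^ m ≤ q ^ (m + 1) := by rw [pow_succ, mul_comm]; exact Nat.mul_le_mul_left _ hq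
    omega

/-- Proper divisors of n are at most n/2, so they contribute at most q + … + q^⌊n/2⌋ to the
preceding identity. -/
theorem lt_mul_card_monicIrreducibles (F : Type*) [Field F] [Fintype F] (n : ℕ) (hn : n ≠ 0) :
    Fintype.card F ^ n < n * (monicIrreducibles F n).card + 2 * Fintype.card F ^ (n / 2) := by
  have hq : 2 ≤ Fintype.card F := Fintype.one_lt_card
  rw [← sum_divisors_mul_card_monicIrreducibles F n hn, ← Nat.cons_self_properDivisors hn,
    Finset.sum_cons]
  refine Nat.add_lt_add_left (lt_of_le_of_lt ?_ (sum_range_pow_succ_lt _ (n / 2) hq)) _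
  rw [← Finset.sum_image (g := fun d => d + 1) (f := fun d => Fintype.card F ^ d)
    (s := Finset.range (n / 2)) (fun _ _ _ _ h => by simpa using h)]
  refine (Finset.sum_le_sum fun d _ => mul_card_monicIrreducibles_le F d).trans
    (Finset.sum_le_sum_of_subset fun d hd => ?_)
  obtain ⟨hd1, hd2⟩ := Nat.mem_properDivisors.1 hd
  obtain ⟨c, rfl⟩ := hd1
  have hd0 : 0 < d := Nat.pos_of_ne_zero fun h => hn (by simp [h])
  have hc : 2 ≤ c := by
    by_contra h
    have : c ≤ 1 := by omega
    have := Nat.mul_le_mul_left d this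
    omega
  refine Finset.mem_image.2 ⟨d - 1, Finset.mem_range.2 ?_, by omega⟩
  have : d * 2 ≤ d * c := Nat.mul_le_mul_left d hc
  omega

/-! ### Mertens-type bounds for sets of primes of given total degree -/

/-- The reciprocal `|P|⁻¹ = q ^ (- deg P)` of the norm of a polynomial. -/
noncomputable def invNorm {F : Type*} [Field F] [Fintype F] (P : F[X]) : ℝ :=
  ((Fintype.card F : ℝ) ^ P.natDegree)⁻¹

theorem invNorm_pos {F : Type*} [Field F] [Fintype F] (P : F[X]) : 0 < invNorm P := by
  have : 0 < Fintype.card F := Fintype.card_pos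
  unfold invNorm; positivity

theorem invNorm_le_half {F : Type*} [Field F] [Fintype F] {P : F[X]} (hP : Irreducible P) :
    invNorm P ≤ 1 / 2 := by
  have hq : (2 : ℝ) ≤ Fintype.card F := by exact_mod_cast (Fintype.one_lt_card : 1 < Fintype.card F)
  have : (2 : ℝ) ≤ (Fintype.card F : ℝ) ^ P.natDegree :=
    hq.trans (le_self_pow₀ (by linarith) hP.natDegree_pos.ne')
  rw [invNorm, ← one_div]
  exact one_div_le_one_div_of_le (by norm_num) this

/-- A linear-programming form of Mertens' estimate: the largest sum of reciprocal norms is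
attained by the irreducibles of smallest degree. -/
theorem IsPrimeSet.sum_invNorm_le {F : Type*} [Field F] [Fintype F] {S : Finset F[X]}
    (hS : IsPrimeSet S) (d m : ℕ) (hd : ∑ P ∈ S, P.natDegree ≤ d) :
    ∑ P ∈ S, invNorm P ≤ harmonic m + ((d : ℝ) - ∑ r ∈ Finset.range m, (Fintype.card F : ℝ) ^ (r + 1))
      / ((m + 1) * (Fintype.card F : ℝ) ^ (m + 1)) := by
  classical
  have hq : (2 : ℝ) ≤ Fintype.card F := by exact_mod_cast (Fintype.one_lt_card : 1 < Fintype.card F)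
  set q : ℝ := (Fintype.card F : ℝ) with hqdef
  -- The dual variable: the price per unit of degree at which a prime of degree m + 1 breaks even.
  -- Since r q^r increases, only degrees at most m can yield a profit, and there are at most q^r / r
  -- primes of degree r.
  set v : ℝ := 1 / ((m + 1) * q ^ (m + 1)) with hv
  have hv0 : 0 < v := by positivity
  have hanti : ∀ r s : ℕ, r ≤ s → (r : ℝ) * q ^ r ≤ s * q ^ s := fun r s h => by
    have := pow_le_pow_right₀ (by linarith : (1 : ℝ) ≤ q) h
    have h' : (r : ℝ) ≤ s := by exact_mod_cast h
    gcongr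
  have h1 : ∑ P ∈ S, (invNorm P - P.natDegree * v)
      ≤ ∑ P ∈ S.filter (fun P => P.natDegree ∈ Finset.Ico 1 (m + 1)),
        (invNorm P - P.natDegree * v) := by
    rw [← Finset.sum_filter_add_sum_filter_not S (fun P => P.natDegree ∈ Finset.Ico 1 (m + 1))]
    refine add_le_of_nonpos_right (Finset.sum_nonpos fun P hP => ?_)
    rw [Finset.mem_filter, Finset.mem_Ico] at hP
    have hP0 := (hS P hP.1).2.natDegree_pos
    have hPm : m + 1 ≤ P.natDegree := by
      by_contra h
      exact hP.2 ⟨hP0, by omega⟩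
    rw [sub_nonpos, invNorm, ← hqdef, hv, mul_one_div, inv_eq_one_div,
      div_le_div_iff₀ (by positivity) (by positivity)]
    have := hanti _ _ hPm
    push_cast at this
    linarith
  have h2 : ∑ P ∈ S.filter (fun P => P.natDegree ∈ Finset.Ico 1 (m + 1)),
        (invNorm P - P.natDegree * v)
      ≤ ∑ r ∈ Finset.Ico 1 (m + 1), (1 / (r : ℝ) - q ^ r * v) := by
    rw [← Finset.sum_fiberwise_of_maps_to (t := Finset.Ico 1 (m + 1))
      (g := fun P : F[X] => P.natDegree) (fun P hP => (Finset.mem_filter.1 hP).2)]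
    refine Finset.sum_le_sum fun r hr => ?_
    rw [Finset.mem_Ico] at hr
    have hr0 : (0 : ℝ) < r := by exact_mod_cast hr.1
    have hnn : 0 ≤ (q ^ r)⁻¹ - r * v := by
      rw [sub_nonneg, hv, mul_one_div, inv_eq_one_div,
        div_le_div_iff₀ (by positivity) (by positivity)]
      have := hanti _ _ hr.2.le
      push_cast at this
      linarith
    have hcard : ((((S.filter (fun P => P.natDegree ∈ Finset.Ico 1 (m + 1))).filter
        (fun P => P.natDegree = r)).card : ℕ) : ℝ) ≤ q ^ r / r := by
      rw [le_div_iff₀ hr0, mul_comm]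
      refine le_trans ?_ (show ((r * (monicIrreducibles F r).card : ℕ) : ℝ) ≤ q ^ r by
        rw [hqdef]; exact_mod_cast mul_card_monicIrreducibles_le F r)
      push_cast
      gcongr
      intro P hP
      simp only [Finset.mem_filter] at hP
      exact mem_monicIrreducibles.2 ⟨(hS P hP.1.1).1, hP.2, (hS P hP.1.1).2⟩
    have hc : ∀ P ∈ (S.filter (fun P => P.natDegree ∈ Finset.Ico 1 (m + 1))).filter
        (fun P => P.natDegree = r), invNorm P - P.natDegree * v = (q ^ r)⁻¹ - r * v := by
      intro P hP
      rw [invNorm, (Finset.mem_filter.1 hP).2]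
    rw [Finset.sum_congr rfl hc, Finset.sum_const, nsmul_eq_mul]
    refine (mul_le_mul_of_nonneg_right hcard hnn).trans (le_of_eq ?_)
    have : q ^ r ≠ 0 := by positivity
    field_simp
  have h3 : ∑ P ∈ S, (P.natDegree : ℝ) * v ≤ d * v := by
    rw [← Finset.sum_mul]
    gcongr
    exact_mod_cast hd
  have h4 : ∑ r ∈ Finset.Ico 1 (m + 1), (1 / (r : ℝ) - q ^ r * v)
      = harmonic m - (∑ r ∈ Finset.range m, q ^ (r + 1)) * v := by
    rw [Finset.sum_Ico_eq_sum_range, Finset.sum_sub_distrib, ← Finset.sum_mul]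
    congr 1
    · simp [harmonic, add_comm]
    · simp [add_comm]
  rw [Finset.sum_sub_distrib] at h1
  have e : ((d : ℝ) - ∑ r ∈ Finset.range m, q ^ (r + 1)) / ((m + 1) * q ^ (m + 1))
      = d * v - (∑ r ∈ Finset.range m, q ^ (r + 1)) * v := by rw [hv]; ring
  rw [e]
  linarith

theorem IsPrimeSet.prod_one_add_invNorm_le {F : Type*} [Field F] [Fintype F] {S : Finset F[X]}
    (hS : IsPrimeSet S) (d : ℕ) (hd2 : 2 ≤ d) (hd : ∑ P ∈ S, P.natDegree ≤ d) :
    ∏ P ∈ S, (1 + invNorm P) ≤ 1 + Real.exp Real.eulerMascheroniConstant *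
      (Real.log d / Real.log (Fintype.card F)) := by
  have hq : 2 ≤ Fintype.card F := Fintype.one_lt_card
  refine (Real.prod_one_add_le_exp_sum S fun P => (invNorm_pos P).le).trans ?_
  obtain ⟨m, h1, h2⟩ : ∃ m, Fintype.card F ^ m ≤ d ∧ d ≤ Fintype.card F ^ (m + 1) :=
    ⟨Nat.log (Fintype.card F) d, Nat.pow_log_le_self _ (by omega),
      (Nat.lt_pow_succ_log_self hq d).le⟩
  refine le_trans (Real.exp_le_exp.2 ?_) (exp_le_one_add_mul_log _ d m hq hd2 h1 h2)
  refine (hS.sum_invNorm_le d m hd).trans ?_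
  gcongr
  split_ifs with hm
  · exact Finset.sum_nonneg fun _ _ => by positivity
  · obtain ⟨k, rfl⟩ := Nat.exists_eq_succ_of_ne_zero hm
    rw [Finset.sum_range_succ]
    exact le_add_of_nonneg_left (Finset.sum_nonneg fun _ _ => by positivity)

theorem IsPrimeSet.prod_one_add_invNorm_le_of_le {F : Type*} [Field F] [Fintype F]
    {S : Finset F[X]} (hS : IsPrimeSet S) (d : ℕ) (hdq : d ≤ Fintype.card F)
    (hd : ∑ P ∈ S, P.natDegree ≤ d) :
    ∏ P ∈ S, (1 + invNorm P) ≤ 1 + Real.exp Real.eulerMascheroniConstant *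
      (d / Fintype.card F) := by
  have hq : 0 < Fintype.card F := Fintype.card_pos
  refine (Real.prod_one_add_le_exp_sum S fun P => (invNorm_pos P).le).trans ?_
  refine le_trans (Real.exp_le_exp.2 ?_) (exp_div_le (Fintype.card F) d (by positivity)
    (by positivity) (by exact_mod_cast hdq))
  simpa using hS.sum_invNorm_le d 0 hd

/-! ### Equidistribution modulo coprime polynomials and the Selberg sieve -/

theorem sum_comp_surjective_hom {G H : Type*} [AddCommGroup G] [AddCommGroup H] [Fintype G]
    [Fintype H] (φ : G →+ H) (hφ : Function.Surjective φ) (Ψ : H → ℝ) :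
    (∑ v, Ψ (φ v)) * Fintype.card H = Fintype.card G * ∑ h, Ψ h := by
  classical
  have hfib : ∀ h : H, (Finset.univ.filter fun v => φ v = h).card
      = (Finset.univ.filter fun v => φ v = 0).card := fun h =>
    AddMonoidHom.card_fiber_eq_of_mem_range φ (hφ h) (hφ 0)
  set k := (Finset.univ.filter fun v => φ v = 0).card
  have h1 : ∀ Θ : H → ℝ, ∑ v, Θ (φ v) = k * ∑ h, Θ h := by
    intro Θ
    rw [← Finset.sum_fiberwise Finset.univ φ, Finset.mul_sum]
    refine Finset.sum_congr rfl fun h _ => ?_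
    rw [Finset.sum_congr rfl (g := fun _ => Θ h)
      (fun v hv => by rw [(Finset.mem_filter.1 hv).2]), Finset.sum_const, hfib, nsmul_eq_mul]
  have h2 := h1 fun _ => 1
  simp only [Finset.sum_const, Finset.card_univ, nsmul_eq_mul, mul_one] at h2
  rw [h1, h2]
  ring

theorem finite_quotient_span {F : Type*} [Field F] [Finite F] {P : F[X]} (hP : P.Monic) :
    Finite (F[X] ⧸ Ideal.span {P}) := by
  have : Module.Finite F (AdjoinRoot P) := hP.finite_adjoinRoot
  exact Module.finite_of_finite F (M := AdjoinRoot P)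

theorem card_quotient_span {F : Type*} [Field F] [Fintype F] {P : F[X]}
    [Fintype (F[X] ⧸ Ideal.span {P})] :
    Fintype.card (F[X] ⧸ Ideal.span {P}) = Fintype.card F ^ P.natDegree := by
  rw [Module.card_eq_pow_finrank (K := F), finrank_quotient_span_eq_natDegree]

/-- Equidistribution of the monic polynomials of degree `n` among residues modulo coprime
polynomials of total degree at most `n`. -/
theorem sum_monicPolys_prod {F : Type*} [Field F] [Fintype F] {ι : Type*} [Fintype ι]
    (P : ι → F[X]) (hmon : ∀ i, (P i).Monic) (hcop : Pairwise (Function.onFun IsCoprime P))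
    (n : ℕ) (hn : ∑ i, (P i).natDegree ≤ n) [∀ i, Fintype (F[X] ⧸ Ideal.span {P i})]
    (ψ : ∀ i, (F[X] ⧸ Ideal.span {P i}) → ℝ) :
    (∑ f ∈ monicPolys F n, ∏ i, ψ i (Ideal.Quotient.mk _ f))
        * ∏ i, (Fintype.card F : ℝ) ^ (P i).natDegree
      = (Fintype.card F : ℝ) ^ n * ∏ i, ∑ y, ψ i y := by
  classical
  -- Without the fixed term X^n the lower coefficients form a group. Surjectivity is the Chinese
  -- remainder theorem followed by reduction modulo ∏ P i, whose degree is at most n.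
  let φ : (Fin n → F) →+ ∀ i, F[X] ⧸ Ideal.span {P i} :=
    { toFun := fun v i => Ideal.Quotient.mk _ ((Polynomial.degreeLTEquiv F n).symm v : F[X])
      map_zero' := by ext i; simp
      map_add' := fun v w => by ext i; simp }
  have hφ : Function.Surjective φ := by
    intro y
    have hI : Pairwise (Function.onFun IsCoprime fun i => Ideal.span {P i}) := fun i j hij =>
      (Ideal.isCoprime_span_singleton_iff _ _).2 (hcop hij)
    obtain ⟨r, hr⟩ := Ideal.pi_quotient_surjective hI y
    set D := ∏ i, P i with hD
    have hDm : D.Monic := Polynomial.monic_prod_of_monic _ _ fun i _ => hmon i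
    have hDd : D.natDegree ≤ n := by
      rw [hD, Polynomial.natDegree_prod_of_monic _ _ fun i _ => hmon i]; exact hn
    have hmem : r %ₘ D ∈ Polynomial.degreeLT F n := by
      rw [Polynomial.mem_degreeLT]
      refine (Polynomial.degree_modByMonic_lt r hDm).trans_le ?_
      exact Polynomial.degree_le_of_natDegree_le hDd
    refine ⟨Polynomial.degreeLTEquiv F n ⟨_, hmem⟩, ?_⟩
    ext i
    rw [← hr i]
    simp only [φ, AddMonoidHom.coe_mk, ZeroHom.coe_mk, LinearEquiv.symm_apply_apply]
    refine Ideal.Quotient.eq.2 (Ideal.mem_span_singleton.2 ?_)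
    have h1 : P i ∣ D := Finset.dvd_prod_of_mem P (Finset.mem_univ i)
    have h2 := Polynomial.modByMonic_add_div r D
    have h3 : r %ₘ D - r = -(D * (r /ₘ D)) := by linear_combination h2
    rw [h3]
    exact (h1.mul_right _).neg_right
  have key := sum_comp_surjective_hom φ hφ
    (fun h => ∏ i, ψ i (Ideal.Quotient.mk _ (Polynomial.X ^ n) + h i))
  have e1 : ∑ f ∈ monicPolys F n, ∏ i, ψ i (Ideal.Quotient.mk _ f)
      = ∑ v, ∏ i, ψ i (Ideal.Quotient.mk _ (Polynomial.X ^ n) + φ v i) := by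
    rw [monicPolys, Finset.sum_map]
    refine Finset.sum_congr rfl fun v _ => Finset.prod_congr rfl fun i _ => ?_
    simp only [Function.Embedding.coeFn_mk, monicOfCoeffs, map_add]
    rfl
  have e2 : ∑ h : (∀ i, F[X] ⧸ Ideal.span {P i}),
      ∏ i, ψ i (Ideal.Quotient.mk _ (Polynomial.X ^ n) + h i) = ∏ i, ∑ y, ψ i y := by
    rw [← Fintype.prod_sum fun i y => ψ i (Ideal.Quotient.mk _ (Polynomial.X ^ n) + y)]
    exact Finset.prod_congr rfl fun i _ =>
      Equiv.sum_comp (Equiv.addLeft (Ideal.Quotient.mk _ (Polynomial.X ^ n))) (ψ i)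
  rw [← e1, e2, Fintype.card_pi] at key
  simp only [card_quotient_span, Fintype.card_pi, Finset.prod_const, Finset.card_univ,
    Fintype.card_fin] at key
  push_cast at key
  exact key

/-- The function on residues modulo `P` which is `-1` on `Ω` and `h` off `Ω`. -/
noncomputable def siftWeight {F : Type*} [Field F] {P : F[X]}
    (Ω : Set (F[X] ⧸ Ideal.span {P})) (h : ℝ) (y : F[X] ⧸ Ideal.span {P}) : ℝ :=
  open scoped Classical in if y ∈ Ω then -1 else h

/-- The value off Ω is the one orthogonal to constants. The mean square is then that same value, so
the sieve sum is both the value of T on the sifted set and its mean square. -/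
theorem sum_siftWeight {F : Type*} [Field F] {P : F[X]} [Fintype (F[X] ⧸ Ideal.span {P})]
    (Ω : Set (F[X] ⧸ Ideal.span {P})) (hlt : Ω.ncard < Fintype.card (F[X] ⧸ Ideal.span {P})) :
    ∑ y, siftWeight Ω (Ω.ncard / (Fintype.card (F[X] ⧸ Ideal.span {P}) - Ω.ncard)) y = 0 ∧
    ∑ y, siftWeight Ω (Ω.ncard / (Fintype.card (F[X] ⧸ Ideal.span {P}) - Ω.ncard)) y ^ 2
      = Fintype.card (F[X] ⧸ Ideal.span {P}) *
        (Ω.ncard / (Fintype.card (F[X] ⧸ Ideal.span {P}) - Ω.ncard)) := by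
  classical
  set N := Fintype.card (F[X] ⧸ Ideal.span {P}) with hN
  have hlt' : (Ω.ncard : ℝ) < N := by exact_mod_cast hlt
  have hne : (N : ℝ) - Ω.ncard ≠ 0 := by linarith
  have hc : (Finset.univ.filter fun y => y ∈ Ω).card = Ω.ncard := by
    rw [Set.ncard_eq_toFinset_card', Set.toFinset_card, Fintype.card_subtype]
  have hc' : ((Finset.univ.filter fun y => y ∉ Ω).card : ℝ) = N - Ω.ncard := by
    have := Finset.card_filter_add_card_filter_not (s := Finset.univ) (fun y => y ∈ Ω)
    rw [hc, Finset.card_univ, ← hN] at this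
    have h : ((Ω.ncard + (Finset.univ.filter fun y => y ∉ Ω).card : ℕ) : ℝ) = N := by rw [this]
    push_cast at h
    linarith
  constructor
  · simp only [siftWeight]
    rw [Finset.sum_ite, Finset.sum_const, Finset.sum_const, hc, nsmul_eq_mul, nsmul_eq_mul, hc']
    field_simp
    ring
  · simp only [siftWeight, ite_pow]
    rw [Finset.sum_ite, Finset.sum_const, Finset.sum_const, hc, nsmul_eq_mul, nsmul_eq_mul, hc']
    field_simp
    ring

/-- The sum of `∏_{P ∈ E} h P` over the subsets `E` of `S` of total degree at most `Q`. -/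
noncomputable def truncatedSum {F : Type*} [Field F] (S : Finset F[X]) (h : F[X] → ℝ) (Q : ℕ) : ℝ :=
  ∑ E ∈ S.powerset with ∑ P ∈ E, P.natDegree ≤ Q, ∏ P ∈ E, h P

/-- An error-free Selberg sieve for monic polynomials of degree `n`, at level `2 Q ≤ n`. -/
theorem IsPrimeSet.selberg_sieve {F : Type*} [Field F] [Fintype F] {S : Finset F[X]}
    (hS : IsPrimeSet S) (n Q : ℕ) (hQ : 2 * Q ≤ n) (Ω : ∀ P : F[X], Set (F[X] ⧸ Ideal.span {P}))
    (hΩ : ∀ P ∈ S, (Ω P).ncard < Fintype.card F ^ P.natDegree)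
    (A : Finset F[X]) (hA : A ⊆ monicPolys F n)
    (hAΩ : ∀ f ∈ A, ∀ P ∈ S, Ideal.Quotient.mk _ f ∉ Ω P) :
    (A.card : ℝ) * truncatedSum S
      (fun P => (Ω P).ncard / ((Fintype.card F : ℝ) ^ P.natDegree - (Ω P).ncard)) Q
      ≤ (Fintype.card F : ℝ) ^ n := by
  classical
  set h : F[X] → ℝ := fun P => (Ω P).ncard / ((Fintype.card F : ℝ) ^ P.natDegree - (Ω P).ncard)
    with hh
  have hq : (0 : ℝ) < Fintype.card F := by exact_mod_cast (Fintype.card_pos : 0 < Fintype.card F)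
  let φ : F[X] → F[X] → ℝ := fun P f => siftWeight (Ω P) (h P) (Ideal.Quotient.mk _ f)
  let 𝓔 := S.powerset.filter fun E => ∑ P ∈ E, P.natDegree ≤ Q
  -- T equals the truncated sum L on A, while by orthogonality its mean square over all monic
  -- polynomials of degree n is L; hence A.card * L² ≤ q^n L.
  let T : F[X] → ℝ := fun f => ∑ E ∈ 𝓔, ∏ P ∈ E, φ P f
  have h0 : ∀ P ∈ S, 0 ≤ h P := fun P hP => by
    have : ((Ω P).ncard : ℝ) < (Fintype.card F : ℝ) ^ P.natDegree := by exact_mod_cast hΩ P hP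
    exact div_nonneg (Nat.cast_nonneg _) (by linarith)
  -- The primes of E ∪ E' have total degree at most 2Q ≤ n, so equidistribution is exact; a prime in
  -- only one of the two sets contributes a factor of mean zero.
  have horth : ∀ E ∈ 𝓔, ∀ E' ∈ 𝓔, ∑ f ∈ monicPolys F n, (∏ P ∈ E, φ P f) * ∏ P ∈ E', φ P f
      = if E = E' then (Fintype.card F : ℝ) ^ n * ∏ P ∈ E, h P else 0 := by
    intro E hE E' hE'
    simp only [𝓔, Finset.mem_filter, Finset.mem_powerset] at hE hE'
    have hU : IsPrimeSet (E ∪ E') := hS.mono (Finset.union_subset hE.1 hE'.1)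
    have hfin : ∀ i : ↥(E ∪ E'), Fintype (F[X] ⧸ Ideal.span {(i : F[X])}) := fun i =>
      @Fintype.ofFinite _ (finite_quotient_span (hU i i.2).1)
    have hdeg : ∑ i : ↥(E ∪ E'), (i : F[X]).natDegree ≤ n := by
      rw [Finset.sum_coe_sort (E ∪ E') fun P => P.natDegree]
      have := Finset.sum_union_inter (s₁ := E) (s₂ := E') (f := fun P => P.natDegree)
      omega
    let χ : ∀ P : F[X], (F[X] ⧸ Ideal.span {P}) → ℝ := fun P y =>
      (if P ∈ E then siftWeight (Ω P) (h P) y else 1) *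
        (if P ∈ E' then siftWeight (Ω P) (h P) y else 1)
    have hprod : ∀ f : F[X], (∏ P ∈ E, φ P f) * ∏ P ∈ E', φ P f
        = ∏ i : ↥(E ∪ E'), χ i (Ideal.Quotient.mk _ f) := by
      intro f
      rw [Finset.prod_coe_sort (E ∪ E') fun P => χ P (Ideal.Quotient.mk _ f)]
      simp only [χ]
      rw [Finset.prod_mul_distrib, ← Finset.prod_filter, ← Finset.prod_filter,
        Finset.filter_mem_eq_inter, Finset.filter_mem_eq_inter,
        Finset.inter_eq_right.2 Finset.subset_union_left,
        Finset.inter_eq_right.2 Finset.subset_union_right]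
    have heq := sum_monicPolys_prod (fun i : ↥(E ∪ E') => (i : F[X])) (fun i => (hU i i.2).1)
      (fun i j hij => hU.isCoprime i.2 j.2 fun h => hij (Subtype.ext h)) n hdeg
      (fun i => χ i)
    rw [← Finset.sum_congr rfl fun f _ => hprod f] at heq
    have hpos : 0 < ∏ i : ↥(E ∪ E'), (Fintype.card F : ℝ) ^ (i : F[X]).natDegree :=
      Finset.prod_pos fun _ _ => by positivity
    have hsift : ∀ i : ↥(E ∪ E'), ∑ y, siftWeight (Ω i) (h i) y = 0 ∧
        ∑ y, siftWeight (Ω i) (h i) y ^ 2 = (Fintype.card F : ℝ) ^ (i : F[X]).natDegree * h i := by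
      intro i
      have hi : (i : F[X]) ∈ S := Finset.union_subset hE.1 hE'.1 i.2
      have := sum_siftWeight (Ω i) (by rw [card_quotient_span]; exact hΩ i hi)
      simp only [card_quotient_span, Nat.cast_pow] at this
      exact this
    by_cases hEE : E = E'
    · rw [if_pos hEE]
      have e : ∏ i : ↥(E ∪ E'), ∑ y, χ i y
          = (∏ i : ↥(E ∪ E'), (Fintype.card F : ℝ) ^ (i : F[X]).natDegree) * ∏ P ∈ E, h P := by
        have e' : ∏ P ∈ E, h P = ∏ i : ↥(E ∪ E'), h i := by
          rw [Finset.prod_coe_sort (E ∪ E') h, ← hEE, Finset.union_self]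
        rw [e', ← Finset.prod_mul_distrib]
        refine Finset.prod_congr rfl fun i _ => ?_
        rw [← (hsift i).2]
        have hi : (i : F[X]) ∈ E := by
          rcases Finset.mem_union.1 i.2 with h | h
          · exact h
          · exact hEE.symm ▸ h
        have hi' : (i : F[X]) ∈ E' := hEE ▸ hi
        simp only [χ, if_pos hi, if_pos hi', sq]
      rw [e] at heq
      apply mul_right_cancel₀ hpos.ne'
      rw [heq]; ring
    · rw [if_neg hEE]
      have e : ∏ i : ↥(E ∪ E'), ∑ y, χ i y = 0 := by
        obtain ⟨P, hP⟩ : ∃ P, ¬(P ∈ E ↔ P ∈ E') := by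
          by_contra hcon; push Not at hcon; exact hEE (Finset.ext hcon)
        have hPU : P ∈ E ∪ E' := by rw [Finset.mem_union]; tauto
        refine Finset.prod_eq_zero (Finset.mem_univ ⟨P, hPU⟩) ?_
        rw [← (hsift ⟨P, hPU⟩).1]
        refine Finset.sum_congr rfl fun y _ => ?_
        simp only [χ]
        by_cases hPE : P ∈ E <;> by_cases hPE' : P ∈ E' <;> simp_all
      rw [e, mul_zero] at heq
      exact (mul_eq_zero.1 heq).resolve_right hpos.ne'
  have hL : truncatedSum S h Q = ∑ E ∈ 𝓔, ∏ P ∈ E, h P := rfl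
  set L := truncatedSum S h Q
  have hT2 : ∑ f ∈ monicPolys F n, T f ^ 2 = (Fintype.card F : ℝ) ^ n * L := by
    simp only [T, sq, Finset.sum_mul_sum]
    rw [Finset.sum_comm, hL, Finset.mul_sum]
    refine Finset.sum_congr rfl fun E hE => ?_
    rw [Finset.sum_comm, Finset.sum_congr rfl fun E' hE' => horth E hE E' hE', Finset.sum_ite_eq,
      if_pos hE]
  have hTA : ∀ f ∈ A, T f = L := by
    intro f hf
    rw [hL]
    refine Finset.sum_congr rfl fun E hE => Finset.prod_congr rfl fun P hP => ?_
    simp only [𝓔, Finset.mem_filter, Finset.mem_powerset] at hE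
    simp only [φ, siftWeight, if_neg (hAΩ f hf P (hE.1 hP))]
  have hL1 : 1 ≤ L := by
    rw [hL]
    refine le_trans (by simp) (Finset.single_le_sum (f := fun E => ∏ P ∈ E, h P) (s := 𝓔)
      (fun E hE => Finset.prod_nonneg fun P hP => h0 P ?_) (show ∅ ∈ 𝓔 by simp [𝓔]))
    exact Finset.mem_powerset.1 (Finset.mem_filter.1 hE).1 hP
  have hfinal : (A.card : ℝ) * L ^ 2 ≤ (Fintype.card F : ℝ) ^ n * L := by
    have hTsum : ∑ f ∈ A, T f ^ 2 = A.card * L ^ 2 := by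
      rw [Finset.sum_congr rfl fun f hf => by rw [hTA f hf], Finset.sum_const, nsmul_eq_mul]
    rw [← hT2, ← hTsum]
    exact Finset.sum_le_sum_of_subset_of_nonneg hA fun _ _ _ => sq_nonneg _
  rw [sq, ← mul_assoc] at hfinal
  exact le_of_mul_le_mul_right hfinal (by linarith)

/-! ### Lower bound for the sieve sum by comparison with smooth polynomials -/

/-- The sequence `A` delayed by `r` steps. -/
def delay (r : ℕ) (A : ℕ → ℝ) (j : ℕ) : ℝ := if r ≤ j then A (j - r) else 0

theorem delay_nonneg {r : ℕ} {A : ℕ → ℝ} (hA : ∀ j, 0 ≤ A j) (j : ℕ) : 0 ≤ delay r A j := by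
  unfold delay; split_ifs <;> simp [hA]

theorem delay_mono {r : ℕ} {A : ℕ → ℝ} (hA : ∀ j, 0 ≤ A j) (hm : Monotone A) :
    Monotone (delay r A) := by
  intro i j hij
  unfold delay
  split_ifs with h1 h2
  · exact hm (by omega)
  · omega
  · exact hA _
  · exact le_rfl

theorem delay_le {r : ℕ} {A : ℕ → ℝ} (hA : ∀ j, 0 ≤ A j) (hm : Monotone A) (j : ℕ) :
    delay r A j ≤ A j := by
  unfold delay
  split_ifs
  · exact hm (by omega)
  · exact hA _

/-- Comparison of a geometric recursion with its two-term majorant. -/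
theorem le_add_mul_delay {r : ℕ} (hr : 0 < r) {x : ℝ} (hx0 : 0 ≤ x) (hx1 : x < 1)
    {A W V : ℕ → ℝ} (hA : ∀ j, 0 ≤ A j) (hm : Monotone A) (hW : ∀ j, W j ≤ A j)
    (hV : ∀ j, V j = W j + x * delay r V j) (j : ℕ) :
    V j ≤ A j + x / (1 - x) * delay r A j := by
  have hx : 0 < 1 - x := by linarith
  -- Unrolled, V is the sum of the x^i W delayed by i r. As W ≤ A and A is monotone, all positive
  -- delays may be replaced by a single one, with total weight x + x² + … = x / (1 − x).
  induction j using Nat.strong_induction_on with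
  | _ j ih =>
    rw [hV j]
    refine add_le_add (hW j) ?_
    by_cases h : r ≤ j
    · rw [delay, if_pos h, delay, if_pos h]
      have h1 := ih (j - r) (by omega)
      have h2 := mul_le_mul_of_nonneg_left (delay_le hA hm (r := r) (j - r))
        (by positivity : 0 ≤ x / (1 - x))
      calc x * V (j - r) ≤ x * (A (j - r) + x / (1 - x) * A (j - r)) := by
            gcongr; linarith
        _ = x / (1 - x) * A (j - r) := by field_simp; ring
    · simp [delay, h]

/-- Local densities of the twin-prime sieve: the compensating factor at primes dividing `a`. -/
noncomputable def twinFactor {F : Type*} [Field F] [Fintype F] (a P : F[X]) : ℝ :=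
  open scoped Classical in if P ∣ a then 1 / (1 - invNorm P) else 1

/-- The sieve weights `ω / (|P| - ω)`, with `ω = 1` for `P ∣ a` and `ω = 2` otherwise. -/
noncomputable def twinWeight {F : Type*} [Field F] [Fintype F] (a P : F[X]) : ℝ :=
  open scoped Classical in
  if P ∣ a then invNorm P / (1 - invNorm P) else 2 * invNorm P / (1 - 2 * invNorm P)

open Classical in
/-- The proportion of monic polynomials of degree `j` whose irreducible factors lie in `S`. -/
noncomputable def smoothDensity {F : Type*} [Field F] [Fintype F] (S : Finset F[X]) (j : ℕ) : ℝ :=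
  (((monicPolys F j).filter fun f => ∀ P, P.Monic → Irreducible P → P ∣ f → P ∈ S).card : ℝ)
    / (Fintype.card F : ℝ) ^ j

theorem smoothDensity_nonneg {F : Type*} [Field F] [Fintype F] (S : Finset F[X]) (j : ℕ) :
    0 ≤ smoothDensity S j := by unfold smoothDensity; positivity

theorem smoothDensity_le_one {F : Type*} [Field F] [Fintype F] (S : Finset F[X]) (j : ℕ) :
    smoothDensity S j ≤ 1 := by
  classical
  have hq : (0 : ℝ) < Fintype.card F := by exact_mod_cast (Fintype.card_pos : 0 < Fintype.card F)
  rw [smoothDensity, div_le_one (by positivity)]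
  have := card_monicPolys F j
  calc _ ≤ ((monicPolys F j).card : ℝ) := by exact_mod_cast Finset.card_filter_le _ _
    _ = _ := by rw [this]; push_cast; rfl

theorem smoothDensity_eq_one {F : Type*} [Field F] [Fintype F] (S : Finset F[X]) (j : ℕ)
    (hS : ∀ P : F[X], P.Monic → Irreducible P → P.natDegree ≤ j → P ∈ S) :
    smoothDensity S j = 1 := by
  classical
  have hq : (0 : ℝ) < Fintype.card F := by exact_mod_cast (Fintype.card_pos : 0 < Fintype.card F)
  rw [smoothDensity, Finset.filter_true_of_mem, card_monicPolys]
  · push_cast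
    exact div_self (by positivity)
  · intro f hf P hP hPi hd
    obtain ⟨hfm, hfd⟩ := mem_monicPolys.1 hf
    exact hS P hP hPi (hfd ▸ Polynomial.natDegree_le_of_dvd hd hfm.ne_zero)

theorem smoothDensity_empty {F : Type*} [Field F] [Fintype F] (j : ℕ) :
    smoothDensity (∅ : Finset F[X]) j = if j = 0 then 1 else 0 := by
  classical
  split_ifs with h
  · subst h
    exact smoothDensity_eq_one _ _ fun P _ hP hd => absurd hP.natDegree_pos (by omega)
  · rw [smoothDensity, Finset.filter_false_of_mem, Finset.card_empty, Nat.cast_zero, zero_div]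
    intro f hf hcon
    obtain ⟨hfm, hfd⟩ := mem_monicPolys.1 hf
    obtain ⟨P, hP, hPi, hd⟩ := Polynomial.exists_monic_irreducible_factor f
      (Polynomial.not_isUnit_of_natDegree_pos f (by omega))
    simpa using hcon P hP hPi hd

theorem smoothDensity_insert {F : Type*} [Field F] [Fintype F] [DecidableEq F[X]]
    {S : Finset F[X]} {P : F[X]} (hP : P.Monic) (hPi : Irreducible P) (hPS : P ∉ S) (j : ℕ) :
    smoothDensity (insert P S) j
      = smoothDensity S j + invNorm P * delay P.natDegree (smoothDensity (insert P S)) j := by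
  classical
  have hq : (0 : ℝ) < Fintype.card F := by exact_mod_cast (Fintype.card_pos : 0 < Fintype.card F)
  set B := (monicPolys F j).filter fun f => ∀ R, R.Monic → Irreducible R → R ∣ f → R ∈ insert P S
    with hB
  have h1 : B.filter (fun f => ¬ P ∣ f)
      = (monicPolys F j).filter fun f => ∀ R, R.Monic → Irreducible R → R ∣ f → R ∈ S := by
    ext f
    simp only [hB, Finset.mem_filter]
    constructor
    · rintro ⟨⟨hf, h⟩, hPf⟩
      refine ⟨hf, fun R h1 h2 h3 => (Finset.mem_insert.1 (h R h1 h2 h3)).resolve_left ?_⟩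
      rintro rfl
      exact hPf h3
    · rintro ⟨hf, h⟩
      exact ⟨⟨hf, fun R h1 h2 h3 => Finset.mem_insert_of_mem (h R h1 h2 h3)⟩,
        fun hd => hPS (h P hP hPi hd)⟩
  have h2 : ((B.filter (fun f => P ∣ f)).card : ℝ) / (Fintype.card F : ℝ) ^ j
      = invNorm P * delay P.natDegree (smoothDensity (insert P S)) j := by
    by_cases hj : P.natDegree ≤ j
    · rw [delay, if_pos hj, smoothDensity, invNorm]
      have e : B.filter (fun f => P ∣ f) = ((monicPolys F (j - P.natDegree)).filter fun f =>
          ∀ R, R.Monic → Irreducible R → R ∣ f → R ∈ insert P S).image (fun f => P * f) := by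
        ext f
        simp only [hB, Finset.mem_filter, Finset.mem_image, mem_monicPolys]
        constructor
        · rintro ⟨⟨⟨hfm, hfd⟩, h⟩, g, rfl⟩
          have hg : g.Monic := hP.of_mul_monic_left hfm
          rw [hP.natDegree_mul hg] at hfd
          exact ⟨g, ⟨⟨hg, by omega⟩, fun R a b c => h R a b (c.mul_left P)⟩, rfl⟩
        · rintro ⟨g, ⟨⟨hg, hd⟩, h⟩, rfl⟩
          refine ⟨⟨⟨hP.mul hg, by rw [hP.natDegree_mul hg]; omega⟩, fun R a b c => ?_⟩,
            dvd_mul_right _ _⟩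
          rcases b.prime.dvd_or_dvd c with hc | hc
          · rw [Polynomial.eq_of_monic_of_associated a hP (b.associated_of_dvd hPi hc)]
            exact Finset.mem_insert_self _ _
          · exact h R a b hc
      rw [e, Finset.card_image_of_injective _ (mul_right_injective₀ hP.ne_zero)]
      have : (Fintype.card F : ℝ) ^ j
          = (Fintype.card F : ℝ) ^ P.natDegree * (Fintype.card F : ℝ) ^ (j - P.natDegree) := by
        rw [← pow_add]; congr 1; omega
      rw [this]
      field_simp
    · rw [delay, if_neg hj, Finset.filter_false_of_mem]
      · simp
      · intro f hf hd
        obtain ⟨hfm, hfd⟩ := mem_monicPolys.1 (Finset.mem_filter.1 hf).1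
        exact hj (hfd ▸ Polynomial.natDegree_le_of_dvd hd hfm.ne_zero)
  have hcard := Finset.card_filter_add_card_filter_not (s := B) (fun f => P ∣ f)
  rw [← h2]
  unfold smoothDensity
  rw [← h1, ← add_div, add_comm]
  congr 1
  exact_mod_cast hcard.symm

/-- A partial Euler product of ζ(2) = 1/(1 − 1/q): it equals the sum of `smoothDensity S j` times
q^(−j), and densities are at most 1. -/
theorem prod_one_div_one_sub_invNorm_sq_le {F : Type*} [Field F] [Fintype F] {S : Finset F[X]}
    (hS : IsPrimeSet S) :
    ∏ P ∈ S, 1 / (1 - invNorm P ^ 2) ≤ (Fintype.card F : ℝ) / (Fintype.card F - 1) := by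
  classical
  have hq : (2 : ℝ) ≤ Fintype.card F := by exact_mod_cast (Fintype.one_lt_card : 1 < Fintype.card F)
  set t : ℝ := (Fintype.card F : ℝ)⁻¹ with ht
  have ht0 : 0 < t := by rw [ht]; positivity
  have ht1 : t < 1 := by rw [ht]; exact inv_lt_one_of_one_lt₀ (by linarith)
  have hgeom := summable_geometric_of_lt_one ht0.le ht1
  have hle : ∀ (S : Finset F[X]) (j : ℕ), smoothDensity S j * t ^ j ≤ t ^ j := fun S j =>
    mul_le_of_le_one_left (by positivity) (smoothDensity_le_one S j)
  have hsum : ∀ S : Finset F[X], Summable fun j => smoothDensity S j * t ^ j := fun S =>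
    Summable.of_nonneg_of_le (fun j => mul_nonneg (smoothDensity_nonneg S j) (by positivity))
      (hle S) hgeom
  have key : ∀ S : Finset F[X], IsPrimeSet S →
      ∏ P ∈ S, 1 / (1 - invNorm P ^ 2) = ∑' j, smoothDensity S j * t ^ j := by
    intro S
    induction S using Finset.induction_on with
    | empty =>
      intro _
      rw [Finset.prod_empty, tsum_eq_single 0 fun j hj => by simp [smoothDensity_empty, hj]]
      simp [smoothDensity_empty]
    | insert P S hPS ih =>
      intro hS
      obtain ⟨hP, hPi⟩ := hS P (Finset.mem_insert_self _ _)
      rw [Finset.prod_insert hPS, ih (hS.mono (Finset.subset_insert _ _))]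
      set f : ℕ → ℝ := fun j => smoothDensity (insert P S) j * t ^ j with hf
      set g : ℕ → ℝ := fun j => smoothDensity S j * t ^ j with hg
      have hx : t ^ P.natDegree = invNorm P := by rw [ht, invNorm, inv_pow]
      have hlow : ∀ j < P.natDegree, f j = g j := by
        intro j hj
        simp only [hf, hg]
        rw [smoothDensity_insert hP hPi hPS, delay, if_neg (by omega), mul_zero, add_zero]
      have hhigh : ∀ j, f (j + P.natDegree) = g (j + P.natDegree) + invNorm P ^ 2 * f j := by
        intro j
        simp only [hf, hg]
        rw [smoothDensity_insert hP hPi hPS, delay, if_pos (by omega), Nat.add_sub_cancel, pow_add,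
          hx]
        ring
      have e1 := (hsum (insert P S)).sum_add_tsum_nat_add P.natDegree
      have e2 := (hsum S).sum_add_tsum_nat_add P.natDegree
      have hgs : Summable fun j => g (j + P.natDegree) :=
        (summable_nat_add_iff P.natDegree).2 (hsum S)
      have e3 : ∑' j, f (j + P.natDegree)
          = ∑' j, g (j + P.natDegree) + invNorm P ^ 2 * ∑' j, f j := by
        rw [tsum_congr hhigh, hgs.tsum_add ((hsum (insert P S)).mul_left _), tsum_mul_left]
      have e4 : ∑ j ∈ Finset.range P.natDegree, f j = ∑ j ∈ Finset.range P.natDegree, g j :=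
        Finset.sum_congr rfl fun j hj => hlow j (Finset.mem_range.1 hj)
      have hx2 := invNorm_le_half hPi
      have hx0 := invNorm_pos P
      have hne : 1 - invNorm P ^ 2 ≠ 0 := by nlinarith
      have e5 : ∑' j, f j = ∑' j, g j + invNorm P ^ 2 * ∑' j, f j := by
        rw [← e2]
        conv_lhs => rw [← e1]
        change ∑ j ∈ Finset.range P.natDegree, f j + ∑' j, f (j + P.natDegree) = _
        rw [e3, e4]
        change _ = ∑ j ∈ Finset.range P.natDegree, g j + ∑' j, g (j + P.natDegree) + _
        ring
      rw [one_div_mul_eq_div, div_eq_iff hne]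
      linear_combination -e5
  rw [key S hS]
  refine ((hsum S).tsum_le_tsum (hle S) hgeom).trans (le_of_eq ?_)
  rw [tsum_geometric_of_lt_one ht0.le ht1, ht]
  have : (Fintype.card F : ℝ) - 1 ≠ 0 := by linarith
  field_simp

section PowerSeriesComparison

open PowerSeries

variable {F : Type*} [Field F] [Fintype F]

/-- The generating series of the pairs of `S`-smooth monic polynomials, summed over degrees. -/
noncomputable def smoothPairSeries (S : Finset F[X]) : PowerSeries ℝ :=
  PowerSeries.mk (smoothDensity S) * (PowerSeries.mk (smoothDensity S) * PowerSeries.mk 1)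

/-- The summed generating series of the sieve weights, with compensating factors. -/
noncomputable def twinSeries (a : F[X]) (S : Finset F[X]) : PowerSeries ℝ :=
  (∏ P ∈ S, (C (twinFactor a P) * (1 + C (twinWeight a P) * X ^ P.natDegree))) * PowerSeries.mk 1

theorem coeff_C_mul_X_pow_mul (x : ℝ) (r : ℕ) (V : PowerSeries ℝ) (j : ℕ) :
    coeff j (C x * X ^ r * V) = x * delay r (fun i => coeff i V) j := by
  rw [mul_assoc, coeff_C_mul, coeff_X_pow_mul', delay]

theorem twinFactor_nonneg {a P : F[X]} (hP : Irreducible P) : 0 ≤ twinFactor a P := by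
  have := invNorm_le_half hP
  have := invNorm_pos P
  unfold twinFactor
  split_ifs
  · exact div_nonneg zero_le_one (by linarith)
  · exact zero_le_one

theorem twinWeight_nonneg {a P : F[X]} (hP : Irreducible P) : 0 ≤ twinWeight a P := by
  have := invNorm_le_half hP
  have := invNorm_pos P
  unfold twinWeight
  split_ifs <;> exact div_nonneg (by linarith) (by linarith)

/-- Prime by prime, with x = 1/|P| and r = deg P, the factor 1/(1 − x u^r)² is replaced by c(1 + h
u^r). The factors themselves do not compare coefficientwise, but after division by 1 − u the
coefficients are monotone and delays can be merged. Each of the two geometric factors costs one use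
of `le_add_mul_delay`. -/
theorem smoothPairSeries_le_twinSeries (a : F[X]) {S : Finset F[X]} (hS : IsPrimeSet S)
    (hlt : ∀ P ∈ S, ¬ P ∣ a → 2 * invNorm P < 1) :
    (∀ j, 0 ≤ coeff j (twinSeries a S)) ∧ (Monotone fun j => coeff j (twinSeries a S)) ∧
      ∀ j, coeff j (smoothPairSeries S) ≤ coeff j (twinSeries a S) := by
  classical
  induction S using Finset.induction_on with
  | empty =>
    have hz : PowerSeries.mk (smoothDensity (∅ : Finset F[X])) = 1 := by
      ext j; rw [coeff_mk, smoothDensity_empty, coeff_one]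
    simp [twinSeries, smoothPairSeries, hz, monotone_const]
  | insert P S hPS ih =>
    obtain ⟨hA, hm, hW⟩ := ih (hS.mono (Finset.subset_insert _ _))
      fun R hR => hlt R (Finset.mem_insert_of_mem hR)
    obtain ⟨hP, hPi⟩ := hS P (Finset.mem_insert_self _ _)
    have hr := hPi.natDegree_pos
    set r := P.natDegree
    set x := invNorm P with hx
    have hx0 : 0 < x := invNorm_pos P
    have hx2 : x ≤ 1 / 2 := invNorm_le_half hPi
    set A : ℕ → ℝ := fun j => coeff j (twinSeries a S) with hAdef
    have hA' : ∀ j, coeff j (twinSeries a (insert P S))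
        = twinFactor a P * (A j + twinWeight a P * delay r A j) := by
      intro j
      rw [twinSeries, Finset.prod_insert hPS, mul_assoc, mul_assoc, coeff_C_mul, add_mul, one_mul,
        map_add, coeff_C_mul_X_pow_mul]
      rfl
    have hc := twinFactor_nonneg (a := a) hPi
    have hh := twinWeight_nonneg (a := a) hPi
    have hz : PowerSeries.mk (smoothDensity (insert P S))
        = PowerSeries.mk (smoothDensity S)
          + C x * X ^ r * PowerSeries.mk (smoothDensity (insert P S)) := by
      ext j
      rw [map_add, coeff_C_mul_X_pow_mul, coeff_mk, coeff_mk, smoothDensity_insert hP hPi hPS]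
      simp only [coeff_mk]
      rfl
    set z := PowerSeries.mk (smoothDensity S)
    set z' := PowerSeries.mk (smoothDensity (insert P S))
    set U : PowerSeries ℝ := z' * (z * PowerSeries.mk 1) with hU
    have hU1 : U = smoothPairSeries S + C x * X ^ r * U := by
      rw [hU, smoothPairSeries]
      linear_combination (z * PowerSeries.mk 1) * hz
    have hU2 : smoothPairSeries (insert P S)
        = U + C x * X ^ r * smoothPairSeries (insert P S) := by
      change z' * (z' * PowerSeries.mk 1) = U + C x * X ^ r * (z' * (z' * PowerSeries.mk 1))
      rw [hU]
      linear_combination (z' * PowerSeries.mk 1) * hz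
    have hUrec : ∀ j, coeff j U = coeff j (smoothPairSeries S)
        + x * delay r (fun i => coeff i U) j := by
      intro j
      conv_lhs => rw [hU1]
      rw [map_add, coeff_C_mul_X_pow_mul]
    have hVrec : ∀ j, coeff j (smoothPairSeries (insert P S)) = coeff j U
        + x * delay r (fun i => coeff i (smoothPairSeries (insert P S))) j := by
      intro j
      conv_lhs => rw [hU2]
      rw [map_add, coeff_C_mul_X_pow_mul]
    set b := x / (1 - x) with hb
    have hb0 : 0 ≤ b := div_nonneg hx0.le (by linarith)
    have hb1 : 1 / (1 - x) = 1 + b := by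
      have : 1 - x ≠ 0 := by linarith
      rw [hb]; field_simp; ring
    have hU3 : ∀ j, coeff j U ≤ A j + b * delay r A j :=
      le_add_mul_delay hr hx0.le (by linarith) hA hm hW hUrec
    have hAd := delay_le (r := r) hA hm
    have hAd0 := delay_nonneg (r := r) hA
    have hmA := delay_mono (r := r) hA hm
    refine ⟨fun j => ?_, fun i j hij => ?_, fun j => ?_⟩
    · rw [hA']
      exact mul_nonneg hc (add_nonneg (hA j) (mul_nonneg hh (hAd0 j)))
    · simp only [hA']
      have h1 : A i ≤ A j := hm hij
      have h2 : delay r A i ≤ delay r A j := hmA hij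
      gcongr
    · rw [hA']
      by_cases hPa : P ∣ a
      -- One geometric factor is bounded outright by 1 + b = 1/(1 − x), the compensating factor; the
      -- other supplies the weight b.
      · have hcA : ∀ j, coeff j U ≤ (1 + b) * A j := fun j => by
          have := mul_le_mul_of_nonneg_left (hAd j) hb0
          have := hU3 j
          linarith
        have h4 := le_add_mul_delay hr hx0.le (by linarith) (A := fun j => (1 + b) * A j)
          (fun j => mul_nonneg (by linarith) (hA j))
          (fun i j hij => mul_le_mul_of_nonneg_left (hm hij) (by linarith)) hcA hVrec j
        refine h4.trans (le_of_eq ?_)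
        rw [twinFactor, twinWeight, if_pos hPa, if_pos hPa, ← hx, hb1, ← hb]
        simp only [delay]
        split_ifs <;> ring
      · have hlt' := hlt P (Finset.mem_insert_self _ _) hPa
        rw [← hx] at hlt'
        have h4 := le_add_mul_delay hr hx0.le (by linarith)
          (A := fun j => A j + b * delay r A j)
          (fun j => add_nonneg (hA j) (mul_nonneg hb0 (hAd0 j)))
          (fun i j hij => add_le_add (hm hij) (mul_le_mul_of_nonneg_left (hmA hij) hb0))
          hU3 hVrec j
        refine h4.trans ?_
        have h5 : delay r (fun j => A j + b * delay r A j) j ≤ (1 + b) * delay r A j := by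
          by_cases hj : r ≤ j
          · have := mul_le_mul_of_nonneg_left (hAd (j - r)) hb0
            have e : delay r A j = A (j - r) := if_pos hj
            rw [e, delay, if_pos hj]
            linarith
          · simp [delay, hj]
        -- The left side is 1/(1 − x)² − 1, so no compensating factor is needed when P does not
        -- divide a.
        have h6 : b + b * (1 + b) ≤ twinWeight a P := by
          rw [twinWeight, if_neg hPa, ← hx, hb]
          have h7 : x / (1 - x) + x / (1 - x) * (1 + x / (1 - x))
              = (2 * x - x ^ 2) / (1 - x) ^ 2 := by
            have : 1 - x ≠ 0 := by linarith
            field_simp; ring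
          have h8 : 0 < 1 - x := by linarith
          rw [h7, div_le_div_iff₀ (by positivity) (by linarith)]
          nlinarith [pow_pos hx0 3]
        have h9 := mul_le_mul_of_nonneg_right h6 (hAd0 j)
        have h10 := mul_le_mul_of_nonneg_left h5 hb0
        rw [twinFactor, if_neg hPa]
        linarith

theorem coeff_twinSeries (a : F[X]) (S : Finset F[X]) (Q : ℕ) :
    coeff Q (twinSeries a S)
      = (∏ P ∈ S, twinFactor a P) * truncatedSum S (twinWeight a) Q := by
  classical
  rw [twinSeries, Finset.prod_mul_distrib, ← map_prod, mul_assoc, coeff_C_mul,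
    Finset.prod_one_add, Finset.sum_mul, map_sum, truncatedSum, Finset.sum_filter]
  congr 1
  refine Finset.sum_congr rfl fun E _ => ?_
  rw [Finset.prod_mul_distrib, ← map_prod, Finset.prod_pow_eq_pow_sum, coeff_C_mul_X_pow_mul, delay]
  simp

/-- All densities up to degree Q are 1, so the coefficient counts the pairs (i, j) with i + j ≤ Q.
-/
theorem coeff_smoothPairSeries (S : Finset F[X]) (Q : ℕ)
    (hS : ∀ P : F[X], P.Monic → Irreducible P → P.natDegree ≤ Q → P ∈ S) :
    coeff Q (smoothPairSeries S) = ((Q : ℝ) + 1) * (Q + 2) / 2 := by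
  have h1 : ∀ j ≤ Q, smoothDensity S j = 1 := fun j hj =>
    smoothDensity_eq_one S j fun P a b c => hS P a b (c.trans hj)
  have h2 : ∀ j ≤ Q, coeff j (PowerSeries.mk (smoothDensity S) * PowerSeries.mk 1)
      = (j : ℝ) + 1 := by
    intro j hj
    rw [coeff_mul, Finset.sum_congr rfl (g := fun _ => (1 : ℝ))]
    · simp
    · intro p hp
      rw [Finset.HasAntidiagonal.mem_antidiagonal] at hp
      rw [coeff_mk, coeff_mk, h1 _ (by omega)]
      simp
  rw [smoothPairSeries, coeff_mul, Finset.sum_congr rfl (g := fun p => (p.2 : ℝ) + 1)]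
  · rw [← Finset.Nat.sum_antidiagonal_swap]
    simp only [Prod.snd_swap]
    rw [Finset.Nat.sum_antidiagonal_eq_sum_range_succ_mk]
    simp only
    clear h1 h2 hS
    induction Q with
    | zero => simp
    | succ Q ih => rw [Finset.sum_range_succ, ih]; push_cast; ring
  · intro p hp
    rw [Finset.HasAntidiagonal.mem_antidiagonal] at hp
    rw [coeff_mk, h1 _ (by omega), h2 _ (by omega), one_mul]

end PowerSeriesComparison

/-! ### The twin-prime upper bound -/

/-- Write 1/(1 − x) = (1 + x)/(1 − x²); the factors 1/(1 − x²) are the origin of q/(q − 1). -/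
theorem prod_twinFactor_le {F : Type*} [Field F] [Fintype F] {a : F[X]} (ha : a ≠ 0)
    {S : Finset F[X]} (hS : IsPrimeSet S) :
    ∏ P ∈ S, twinFactor a P
      ≤ (Fintype.card F : ℝ) / (Fintype.card F - 1) * ∏ P ∈ primeDivisors a, (1 + invNorm P) := by
  classical
  have hT : IsPrimeSet (S.filter (· ∣ a)) := hS.mono (Finset.filter_subset _ _)
  have e : ∏ P ∈ S, twinFactor a P
      = (∏ P ∈ S.filter (· ∣ a), 1 / (1 - invNorm P ^ 2))
        * ∏ P ∈ S.filter (· ∣ a), (1 + invNorm P) := by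
    rw [← Finset.prod_mul_distrib, Finset.prod_filter]
    refine Finset.prod_congr rfl fun P hP => ?_
    unfold twinFactor
    split_ifs
    · have h1 := invNorm_le_half (hS P hP).2
      have h2 := invNorm_pos P
      have h3 : 1 - invNorm P ≠ 0 := by linarith
      have h4 : 1 - invNorm P ^ 2 ≠ 0 := by nlinarith
      field_simp
      ring
    · rfl
  rw [e]
  have hq : (2 : ℝ) ≤ Fintype.card F := by exact_mod_cast (Fintype.one_lt_card : 1 < Fintype.card F)
  have h1 : ∏ P ∈ S.filter (· ∣ a), (1 + invNorm P) ≤ ∏ P ∈ primeDivisors a, (1 + invNorm P) := by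
    refine Finset.prod_le_prod_of_subset_of_one_le (fun P hP => ?_) (fun P _ => ?_)
      fun P _ _ => ?_
    · obtain ⟨h1, h2⟩ := Finset.mem_filter.1 hP
      exact (mem_primeDivisors ha).2 ⟨(hS P h1).1, (hS P h1).2, h2⟩
    all_goals linarith [invNorm_pos P]
  refine mul_le_mul (prod_one_div_one_sub_invNorm_sq_le hT) h1
    (Finset.prod_nonneg fun P _ => by linarith [invNorm_pos P])
    (div_nonneg (by linarith) (by linarith))

open Classical in
/-- An upper bound of the twin-prime type for the number of monic irreducible `h` of degree `n`
with `h + a` irreducible. -/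
theorem card_twin_le {F : Type*} [Field F] [Fintype F] {a : F[X]} (ha : a ≠ 0) (n : ℕ)
    (hn : 1 ≤ n) (han : a.natDegree < n) :
    (((monicIrreducibles F n).filter fun h => Irreducible (h + a)).card : ℝ)
      ≤ 8 * ((Fintype.card F : ℝ) / (Fintype.card F - 1)) * ((Fintype.card F : ℝ) ^ n / n ^ 2) *
        ∏ P ∈ primeDivisors a, (1 + invNorm P) := by
  set A := (monicIrreducibles F n).filter fun h => Irreducible (h + a) with hAdef
  have hq : (2 : ℝ) ≤ Fintype.card F := by exact_mod_cast (Fintype.one_lt_card : 1 < Fintype.card F)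
  have hn' : (1 : ℝ) ≤ n := by exact_mod_cast hn
  have hprod : 0 ≤ ∏ P ∈ primeDivisors a, (1 + invNorm P) :=
    Finset.prod_nonneg fun P _ => by linarith [invNorm_pos P]
  -- The largest level with 2Q ≤ n. As Q < n, no prime of degree at most Q divides an irreducible
  -- polynomial of degree n.
  set Q := n / 2 with hQ
  set S : Finset F[X] := (Finset.range (Q + 1)).biUnion (monicIrreducibles F) with hSdef
  have hmemS : ∀ P : F[X], P ∈ S ↔ P.Monic ∧ Irreducible P ∧ P.natDegree ≤ Q := by
    intro P
    simp only [hSdef, Finset.mem_biUnion, Finset.mem_range, mem_monicIrreducibles]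
    constructor
    · rintro ⟨r, hr, h1, h2, h3⟩; exact ⟨h1, h3, by omega⟩
    · rintro ⟨h1, h2, h3⟩; exact ⟨_, by omega, h1, rfl, h2⟩
  have hS : IsPrimeSet S := fun P hP => ⟨((hmemS P).1 hP).1, ((hmemS P).1 hP).2.1⟩
  let Ω : ∀ P : F[X], Set (F[X] ⧸ Ideal.span {P}) := fun P => {0, Ideal.Quotient.mk _ (-a)}
  have hΩcard : ∀ P : F[X], (Ω P).ncard = if P ∣ a then 1 else 2 := by
    intro P
    simp only [Ω]
    split_ifs with h
    · have : Ideal.Quotient.mk (Ideal.span {P}) (-a) = 0 :=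
        Ideal.Quotient.eq_zero_iff_mem.2 (Ideal.mem_span_singleton.2 h.neg_right)
      rw [this, Set.pair_eq_singleton, Set.ncard_singleton]
    · refine Set.ncard_pair fun h0 => h ?_
      exact (dvd_neg.1 (Ideal.mem_span_singleton.1 (Ideal.Quotient.eq_zero_iff_mem.1 h0.symm)))
  have hnd : ∀ f ∈ A, ∀ P ∈ S, ¬ P ∣ f ∧ ¬ P ∣ f + a := by
    intro f hf P hP
    obtain ⟨hf1, hf2⟩ := Finset.mem_filter.1 hf
    obtain ⟨-, hfd, hfi⟩ := mem_monicIrreducibles.1 hf1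
    obtain ⟨-, hPi, hPd⟩ := (hmemS P).1 hP
    have hdeg : ∀ R : F[X], Irreducible R → R.natDegree = n → ¬ P ∣ R := by
      intro R hR hRd hd
      have := Polynomial.natDegree_eq_of_degree_eq
        (Polynomial.degree_eq_degree_of_associated (hPi.associated_of_dvd hR hd))
      omega
    refine ⟨hdeg f hfi hfd, hdeg _ hf2 ?_⟩
    rw [Polynomial.natDegree_add_eq_left_of_natDegree_lt (by omega), hfd]
  have hAΩ : ∀ f ∈ A, ∀ P ∈ S, Ideal.Quotient.mk _ f ∉ Ω P := by
    intro f hf P hP hmem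
    obtain ⟨h1, h2⟩ := hnd f hf P hP
    rcases hmem with h | h
    · exact h1 (Ideal.mem_span_singleton.1 (Ideal.Quotient.eq_zero_iff_mem.1 h))
    · rw [Set.mem_singleton_iff, Ideal.Quotient.eq, sub_neg_eq_add] at h
      exact h2 (Ideal.mem_span_singleton.1 h)
  have hrhs : 0 ≤ 8 * ((Fintype.card F : ℝ) / (Fintype.card F - 1)) *
      ((Fintype.card F : ℝ) ^ n / n ^ 2) * ∏ P ∈ primeDivisors a, (1 + invNorm P) := by
    have : 0 < (Fintype.card F : ℝ) - 1 := by linarith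
    positivity
  -- The residues 0 and −a can exhaust all classes only if q = 2 and deg P = 1; then nothing
  -- survives and A is empty.
  by_cases hΩ : ∀ P ∈ S, (Ω P).ncard < Fintype.card F ^ P.natDegree
  swap
  · push Not at hΩ
    obtain ⟨P, hP, hle⟩ := hΩ
    have hA0 : A = ∅ := by
      by_contra hne
      obtain ⟨f, hf⟩ := Finset.nonempty_iff_ne_empty.2 hne
      have := finite_quotient_span (hS P hP).1
      have := Fintype.ofFinite (F[X] ⧸ Ideal.span {P})
      have huniv : Ω P = Set.univ := Set.eq_of_subset_of_ncard_le (Set.subset_univ _) (by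
        rw [Set.ncard_univ, Nat.card_eq_fintype_card, card_quotient_span]; exact hle)
      exact hAΩ f hf P hP (huniv ▸ Set.mem_univ _)
    rw [hA0, Finset.card_empty, Nat.cast_zero]
    exact hrhs
  have hsieve := hS.selberg_sieve n Q (by omega) Ω hΩ A
    (fun f hf => mem_monicPolys.2 (by
      have := mem_monicIrreducibles.1 (Finset.mem_filter.1 hf).1
      exact ⟨this.1, this.2.1⟩)) hAΩ
  have hw : truncatedSum S (fun P => ((Ω P).ncard : ℝ) /
      ((Fintype.card F : ℝ) ^ P.natDegree - (Ω P).ncard)) Q = truncatedSum S (twinWeight a) Q := by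
    unfold truncatedSum
    refine Finset.sum_congr rfl fun E hE => Finset.prod_congr rfl fun P hP => ?_
    have hPS := Finset.mem_powerset.1 (Finset.mem_filter.1 hE).1 hP
    have hlt := hΩ P hPS
    have hlt' : ((Ω P).ncard : ℝ) < (Fintype.card F : ℝ) ^ P.natDegree := by exact_mod_cast hlt
    have hp : (0 : ℝ) < (Fintype.card F : ℝ) ^ P.natDegree := by positivity
    beta_reduce
    rw [hΩcard] at hlt' ⊢
    unfold twinWeight invNorm
    split_ifs at hlt' ⊢ with h
    · push_cast at hlt' ⊢
      have h1 : (Fintype.card F : ℝ) ^ P.natDegree - 1 ≠ 0 := by linarith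
      have : 1 - ((Fintype.card F : ℝ) ^ P.natDegree)⁻¹ ≠ 0 := by
        have := inv_lt_one_of_one_lt₀ hlt'
        linarith
      field_simp
    · push_cast at hlt' ⊢
      have h1 : (Fintype.card F : ℝ) ^ P.natDegree - 2 ≠ 0 := by linarith
      have e : 1 - 2 * ((Fintype.card F : ℝ) ^ P.natDegree)⁻¹
        = ((Fintype.card F : ℝ) ^ P.natDegree - 2) / (Fintype.card F : ℝ) ^ P.natDegree := by
        field_simp
      rw [e]
      field_simp
  rw [hw] at hsieve
  have hlt : ∀ P ∈ S, ¬ P ∣ a → 2 * invNorm P < 1 := by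
    intro P hP hPa
    have h1 := hΩ P hP
    rw [hΩcard, if_neg hPa] at h1
    have h2 : (2 : ℝ) < (Fintype.card F : ℝ) ^ P.natDegree := by exact_mod_cast h1
    rw [invNorm, ← div_eq_mul_inv, div_lt_one (by linarith)]
    exact h2
  have hL := (smoothPairSeries_le_twinSeries a hS hlt).2.2 Q
  rw [coeff_twinSeries, coeff_smoothPairSeries S Q fun P a b c => (hmemS P).2 ⟨a, b, c⟩] at hL
  set L := truncatedSum S (twinWeight a) Q
  set c := ∏ P ∈ S, twinFactor a P
  have hc0 : 0 ≤ c := Finset.prod_nonneg fun P hP => twinFactor_nonneg (hS P hP).2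
  -- Source of the constant 8, from n ≤ 2Q + 1.
  have hQn : (n : ℝ) ^ 2 / 8 ≤ ((Q : ℝ) + 1) * (Q + 2) / 2 := by
    have : (n : ℝ) ≤ 2 * Q + 1 := by
      have : n ≤ 2 * Q + 1 := by omega
      exact_mod_cast this
    nlinarith [mul_self_nonneg (Q : ℝ), Nat.cast_nonneg (α := ℝ) Q]
  have h1 : (A.card : ℝ) * (n ^ 2 / 8) ≤ c * (Fintype.card F : ℝ) ^ n := by
    calc (A.card : ℝ) * (n ^ 2 / 8) ≤ A.card * (c * L) := by gcongr; linarith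
      _ = c * (A.card * L) := by ring
      _ ≤ c * (Fintype.card F : ℝ) ^ n := by gcongr
  have h2 : (A.card : ℝ) ≤ 8 * ((Fintype.card F : ℝ) ^ n / n ^ 2) * c := by
    have : 8 * ((Fintype.card F : ℝ) ^ n / n ^ 2) * c
      = c * (Fintype.card F : ℝ) ^ n / ((n : ℝ) ^ 2 / 8) := by field_simp
    rw [this, le_div_iff₀ (by positivity)]
    exact h1
  refine h2.trans ?_
  have h3 := mul_le_mul_of_nonneg_left (prod_twinFactor_le ha hS)
    (by positivity : 0 ≤ 8 * ((Fintype.card F : ℝ) ^ n / n ^ 2))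
  refine h3.trans (le_of_eq ?_)
  ring

/-! ### Orders of g modulo primes and the average over exponents -/

/-- Write 1/e as the sum of 1/(i(i+1)) over e ≤ i < X plus 1/X, and interchange the sums. -/
theorem sum_div_eq_abelSum {α : Type*} (s : Finset α) (ε : α → ℕ) (w : α → ℝ) (X : ℕ)
    (hε : ∀ E ∈ s, 1 ≤ ε E ∧ ε E ≤ X) :
    ∑ E ∈ s, w E / ε E = abelSum (fun i => ∑ E ∈ s with ε E ≤ i, w E) X := by
  have h1 : ∀ e : ℕ, 1 ≤ e → ∀ X : ℕ, e ≤ X →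
      (1 : ℝ) / e = ∑ i ∈ Finset.Ico 1 X, (if e ≤ i then (1 : ℝ) else 0) / (i * (i + 1)) + 1 / X := by
    intro e he X hX
    induction X, hX using Nat.le_induction with
    | base =>
      rw [Finset.sum_eq_zero, zero_add]
      intro i hi
      rw [Finset.mem_Ico] at hi
      rw [if_neg (by omega), zero_div]
    | succ n hn ih =>
      have hn0 : (n : ℝ) ≠ 0 := by
        have : 0 < n := by omega
        positivity
      have e1 : (1 : ℝ) / (n * (n + 1)) + 1 / ((n + 1 : ℕ) : ℝ) = 1 / n := by
        push_cast
        field_simp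
        ring
      rw [Finset.sum_Ico_succ_top (by omega), if_pos hn, add_assoc, e1, ih]
  unfold abelSum
  beta_reduce
  have h2 : ∑ E ∈ s with ε E ≤ X, w E = ∑ E ∈ s, w E := by
    rw [Finset.filter_true_of_mem fun E hE => (hε E hE).2]
  rw [h2, Finset.sum_div]
  simp only [Finset.sum_filter, Finset.sum_div]
  rw [Finset.sum_comm, ← Finset.sum_add_distrib]
  refine Finset.sum_congr rfl fun E hE => ?_
  rw [div_eq_mul_one_div, h1 _ (hε E hE).1 X (hε E hE).2, mul_add, Finset.mul_sum]
  congr 1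
  · refine Finset.sum_congr rfl fun i _ => ?_
    split_ifs <;> ring
  · ring

/-- A polynomial divisible by every irreducible `P` such that `P ∣ g` or `g ^ j ≡ 1 mod P` for
some `1 ≤ j ≤ i`. -/
noncomputable def orderProduct {F : Type*} [Field F] (g : F[X]) (i : ℕ) : F[X] :=
  g * ((g - 1) * ∏ j ∈ Finset.Ico 2 (i + 1), ∑ m ∈ Finset.range j, g ^ m)

section OrderProduct

variable {F : Type*} [Field F] {g : F[X]}

theorem natDegree_pow_sub_one (hg : 1 ≤ g.natDegree) {j : ℕ} (hj : 1 ≤ j) :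
    (g ^ j - 1).natDegree = j * g.natDegree := by
  have : (1 : F[X]).natDegree < (g ^ j).natDegree := by
    rw [Polynomial.natDegree_one, Polynomial.natDegree_pow]
    positivity
  rw [Polynomial.natDegree_sub_eq_left_of_natDegree_lt this, Polynomial.natDegree_pow]

theorem pow_sub_one_ne_zero_of_natDegree_pos (hg : 1 ≤ g.natDegree) {j : ℕ} (hj : 1 ≤ j) : g ^ j - 1 ≠ 0 := by
  intro h
  have := natDegree_pow_sub_one hg hj
  rw [h, Polynomial.natDegree_zero] at this
  have : 0 < j * g.natDegree := by positivity
  omega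

theorem natDegree_geom_sum (hg : 1 ≤ g.natDegree) {j : ℕ} (hj : 1 ≤ j) :
    ∑ m ∈ Finset.range j, g ^ m ≠ 0 ∧
      (∑ m ∈ Finset.range j, g ^ m).natDegree = (j - 1) * g.natDegree := by
  have h := geom_sum_mul g j
  have h0 := pow_sub_one_ne_zero_of_natDegree_pos hg hj
  have hs : ∑ m ∈ Finset.range j, g ^ m ≠ 0 := fun hz => h0 (by rw [← h, hz, zero_mul])
  have h1 : g - 1 ≠ 0 := by simpa using pow_sub_one_ne_zero_of_natDegree_pos hg le_rfl
  refine ⟨hs, ?_⟩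
  have hd := natDegree_pow_sub_one hg hj
  have hd1 : (g - 1).natDegree = g.natDegree := by simpa using natDegree_pow_sub_one hg le_rfl
  rw [← h, Polynomial.natDegree_mul hs h1, hd1] at hd
  obtain ⟨i, rfl⟩ : ∃ i, j = i + 1 := ⟨j - 1, by omega⟩
  simp only [Nat.add_sub_cancel]
  linarith

theorem orderProduct_ne_zero (hg : 1 ≤ g.natDegree) (i : ℕ) : orderProduct g i ≠ 0 := by
  have h0 : g ≠ 0 := by rintro rfl; simp at hg
  have h1 : g - 1 ≠ 0 := by simpa using pow_sub_one_ne_zero_of_natDegree_pos hg le_rfl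
  refine mul_ne_zero h0 (mul_ne_zero h1 (Finset.prod_ne_zero_iff.2 fun j hj => ?_))
  exact (natDegree_geom_sum hg (by rw [Finset.mem_Ico] at hj; omega)).1

theorem natDegree_orderProduct (hg : 1 ≤ g.natDegree) {i : ℕ} (hi : 1 ≤ i) :
    (orderProduct g i).natDegree = g.natDegree * orderDegree i := by
  have h0 : g ≠ 0 := by rintro rfl; simp at hg
  have h1 : g - 1 ≠ 0 := by simpa using pow_sub_one_ne_zero_of_natDegree_pos hg le_rfl
  have hd1 : (g - 1).natDegree = g.natDegree := by simpa using natDegree_pow_sub_one hg le_rfl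
  induction i, hi using Nat.le_induction with
  | base => simp [orderProduct, orderDegree, Polynomial.natDegree_mul h0 h1, hd1, mul_two]
  | succ n hn ih =>
    have e : orderProduct g (n + 1)
        = orderProduct g n * ∑ m ∈ Finset.range (n + 1), g ^ m := by
      unfold orderProduct
      rw [Finset.prod_Ico_succ_top (by omega)]
      ring
    obtain ⟨hs, hd⟩ := natDegree_geom_sum hg (j := n + 1) (by omega)
    rw [e, Polynomial.natDegree_mul (orderProduct_ne_zero hg n) hs, ih, hd]
    simp only [orderDegree, Nat.choose_succ_succ' n 1, Nat.choose_one_right, Nat.add_sub_cancel]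
    ring

/-- A prime dividing g^j − 1 divides g − 1 or the geometric sum. Keeping g − 1 only once lowers the
degree factor from 1 + i(i+1)/2 to 2 + i(i−1)/2. -/
theorem dvd_orderProduct {P : F[X]} (hP : Irreducible P) {i j : ℕ} (hj : 1 ≤ j) (hji : j ≤ i)
    (h : P ∣ g ∨ P ∣ g ^ j - 1) : P ∣ orderProduct g i := by
  rcases h with h | h
  · exact h.mul_right _
  refine Dvd.dvd.mul_left ?_ _
  rw [← geom_sum_mul] at h
  rcases hP.prime.dvd_or_dvd h with h | h
  · rcases eq_or_lt_of_le hj with rfl | h2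
    · simp only [Finset.range_one, Finset.sum_singleton, pow_zero] at h
      exact absurd (isUnit_of_dvd_one h) hP.not_isUnit
    · exact Dvd.dvd.mul_left (h.trans (Finset.dvd_prod_of_mem
        (fun j => ∑ m ∈ Finset.range j, g ^ m) (Finset.mem_Ico.2 ⟨h2, by omega⟩))) _
  · exact h.mul_right _

open Classical in
/-- The order of `g` modulo `P`, set to `1` if `P ∣ g`. -/
noncomputable def orderMod (g P : F[X]) : ℕ :=
  if P ∣ g then 1 else orderOf (Ideal.Quotient.mk (Ideal.span {P}) g)

/-- The convention of order 1 for P ∣ g makes such primes impose no condition on j. -/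
theorem dvd_or_dvd_pow_sub_one_iff {P : F[X]} (j : ℕ) :
    P ∣ g ∨ P ∣ g ^ j - 1 ↔ orderMod g P ∣ j := by
  unfold orderMod
  split_ifs with h
  · simp [h]
  · rw [or_iff_right h, orderOf_dvd_iff_pow_eq_one, ← map_pow, ← map_one (Ideal.Quotient.mk _),
      Ideal.Quotient.eq, Ideal.mem_span_singleton]

end OrderProduct

theorem prod_primeDivisors_orderProduct_le {F : Type*} [Field F] [Fintype F] {g : F[X]}
    (hg : 1 ≤ g.natDegree) {i : ℕ} (hi : 1 ≤ i) :
    ∏ P ∈ primeDivisors (orderProduct g i), (1 + invNorm P)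
        ≤ 1 + Real.exp Real.eulerMascheroniConstant *
          (Real.log (g.natDegree * orderDegree i : ℕ) / Real.log (Fintype.card F)) ∧
      (g.natDegree * orderDegree i ≤ Fintype.card F →
        ∏ P ∈ primeDivisors (orderProduct g i), (1 + invNorm P)
          ≤ 1 + Real.exp Real.eulerMascheroniConstant *
            ((g.natDegree * orderDegree i : ℕ) / Fintype.card F)) := by
  have h0 := orderProduct_ne_zero hg i
  have hS := isPrimeSet_primeDivisors h0
  have hd : ∑ P ∈ primeDivisors (orderProduct g i), P.natDegree ≤ g.natDegree * orderDegree i := by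
    rw [← natDegree_orderProduct hg hi]
    exact hS.sum_natDegree_le h0 fun P hP => ((mem_primeDivisors h0).1 hP).2.2
  refine ⟨hS.prod_one_add_invNorm_le _ ?_ hd, fun hle => hS.prod_one_add_invNorm_le_of_le _ hle hd⟩
  have := Nat.mul_le_mul hg (two_le_orderDegree i)
  simpa using this

/-- The average over `k < l` of the local factors at the primes dividing `g ^ l - g ^ k`. -/
theorem sum_prod_primeDivisors_le {F : Type*} [Field F] [Fintype F] {g : F[X]}
    (hg : 1 ≤ g.natDegree) (l : ℕ) :
    ∑ k ∈ Finset.range l, ∏ P ∈ primeDivisors (g ^ l - g ^ k), (1 + invNorm P)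
      ≤ l * (1 + Real.exp Real.eulerMascheroniConstant *
        min (5 * √((g.natDegree : ℝ) / Fintype.card F))
          (Real.log (6 * (g.natDegree : ℝ)) / Real.log (Fintype.card F))) := by
  classical
  rcases Nat.eq_zero_or_pos l with rfl | hl
  · simp
  have hg0 : g ≠ 0 := by rintro rfl; simp at hg
  set U := primeDivisors (orderProduct g l) with hU
  have hmemU := fun P : F[X] => mem_primeDivisors (P := P) (orderProduct_ne_zero hg l)
  let ε : Finset F[X] → ℕ := fun E => E.lcm (orderMod g)
  let w : Finset F[X] → ℝ := fun E => ∏ P ∈ E, invNorm P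
  have hw0 : ∀ E, 0 ≤ w E := fun E => Finset.prod_nonneg fun P _ => (invNorm_pos P).le
  set 𝓔 := U.powerset.filter fun E => 1 ≤ ε E ∧ ε E ≤ l with h𝓔
  -- In the expanded product, E occurs only if all its primes divide g^k (g^(l−k) − 1), which forces
  -- ε E ∣ l − k. As 0 < l − k ≤ l, this also gives 1 ≤ ε E ≤ l.
  have step1 : ∀ k ∈ Finset.range l, ∏ P ∈ primeDivisors (g ^ l - g ^ k), (1 + invNorm P)
      ≤ ∑ E ∈ 𝓔, if ε E ∣ l - k then w E else 0 := by
    intro k hk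
    rw [Finset.mem_range] at hk
    have hfac : g ^ l - g ^ k = g ^ k * (g ^ (l - k) - 1) := by
      rw [mul_sub, ← pow_add, mul_one]; congr 2; omega
    have hne : g ^ l - g ^ k ≠ 0 := by
      rw [hfac]; exact mul_ne_zero (pow_ne_zero _ hg0) (pow_sub_one_ne_zero_of_natDegree_pos hg (by omega))
    rw [Finset.prod_one_add, ← Finset.sum_filter]
    refine Finset.sum_le_sum_of_subset_of_nonneg (fun E hE => ?_) fun E _ _ => hw0 E
    rw [Finset.mem_powerset] at hE
    have hor : ∀ P ∈ E, Irreducible P ∧ (P ∣ g ∨ P ∣ g ^ (l - k) - 1) := fun P hP => by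
      obtain ⟨-, h2, h3⟩ := (mem_primeDivisors hne).1 (hE hP)
      rw [hfac] at h3
      exact ⟨h2, (h2.prime.dvd_or_dvd h3).imp_left h2.prime.dvd_of_dvd_pow⟩
    have hdvd : ε E ∣ l - k := Finset.lcm_dvd fun P hP =>
      (dvd_or_dvd_pow_sub_one_iff _).1 (hor P hP).2
    simp only [h𝓔, Finset.mem_filter, Finset.mem_powerset]
    refine ⟨⟨fun P hP => (hmemU P).2 ⟨((mem_primeDivisors hne).1 (hE hP)).1, (hor P hP).1,
      dvd_orderProduct (hor P hP).1 (by omega) (by omega) (hor P hP).2⟩,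
      Nat.pos_of_dvd_of_pos hdvd (by omega), (Nat.le_of_dvd (by omega) hdvd).trans (by omega)⟩,
      hdvd⟩
  have step2 : ∀ E ∈ 𝓔, ∑ k ∈ Finset.range l, (if ε E ∣ l - k then w E else 0)
      ≤ l * (w E / ε E) := by
    intro E _
    rw [← Finset.sum_filter, Finset.sum_const, nsmul_eq_mul]
    have hcard : ((Finset.range l).filter fun k => ε E ∣ l - k).card = l / ε E := by
      rw [← Nat.Ioc_filter_dvd_card_eq_div]
      refine Finset.card_bij' (fun k _ => l - k) (fun k _ => l - k) ?_ ?_ ?_ ?_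
      · intro k hk
        simp only [Finset.mem_filter, Finset.mem_range, Finset.mem_Ioc] at hk ⊢
        exact ⟨by omega, hk.2⟩
      · intro k hk
        simp only [Finset.mem_filter, Finset.mem_range, Finset.mem_Ioc] at hk ⊢
        refine ⟨by omega, ?_⟩
        rw [show l - (l - k) = k by omega]; exact hk.2
      · intro k hk
        simp only [Finset.mem_filter, Finset.mem_range] at hk
        omega
      · intro k hk
        simp only [Finset.mem_filter, Finset.mem_Ioc] at hk
        omega
    rw [hcard]
    calc ((l / ε E : ℕ) : ℝ) * w E ≤ (l : ℝ) / ε E * w E :=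
          mul_le_mul_of_nonneg_right Nat.cast_div_le (hw0 E)
      _ = l * (w E / ε E) := by ring
  have step3 : ∑ E ∈ 𝓔, w E / ε E ≤ 1 + Real.exp Real.eulerMascheroniConstant *
        min (5 * √((g.natDegree : ℝ) / Fintype.card F))
          (Real.log (6 * (g.natDegree : ℝ)) / Real.log (Fintype.card F)) := by
    rw [sum_div_eq_abelSum 𝓔 ε w l fun E hE => (Finset.mem_filter.1 hE).2]
    -- Sets with ε E ≤ i consist of primes dividing `orderProduct g i` (take j = ε E), so their
    -- weights are part of the expansion of that product.
    refine (abelSum_mono (v := fun i => ∏ P ∈ primeDivisors (orderProduct g i), (1 + invNorm P))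
      l hl fun i hi => ?_).trans (abelSum_le_min (Fintype.card F) g.natDegree Fintype.one_lt_card hg
        _ (fun i hi => (prod_primeDivisors_orderProduct_le hg hi).1)
        (fun i hi => (prod_primeDivisors_orderProduct_le hg hi).2) l hl)
    rw [Finset.prod_one_add]
    refine Finset.sum_le_sum_of_subset_of_nonneg (fun E hE => ?_) fun E _ _ => hw0 E
    simp only [h𝓔, Finset.mem_filter, Finset.mem_powerset] at hE
    obtain ⟨⟨hEU, h1, -⟩, h2⟩ := hE
    rw [Finset.mem_powerset]
    intro P hP
    obtain ⟨hPm, hPi, -⟩ := (hmemU P).1 (hEU hP)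
    refine (mem_primeDivisors (orderProduct_ne_zero hg i)).2 ⟨hPm, hPi, ?_⟩
    exact dvd_orderProduct hPi h1 h2 ((dvd_or_dvd_pow_sub_one_iff _).2 (Finset.dvd_lcm hP))
  calc _ ≤ ∑ k ∈ Finset.range l, ∑ E ∈ 𝓔, (if ε E ∣ l - k then w E else 0) :=
        Finset.sum_le_sum step1
    _ = ∑ E ∈ 𝓔, ∑ k ∈ Finset.range l, (if ε E ∣ l - k then w E else 0) := Finset.sum_comm
    _ ≤ ∑ E ∈ 𝓔, l * (w E / ε E) := Finset.sum_le_sum step2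
    _ = l * ∑ E ∈ 𝓔, w E / ε E := by rw [Finset.mul_sum]
    _ ≤ _ := by gcongr

/-! ### Second moment and the final estimate -/

theorem sum_range_sum_range_symm (s : ℕ → ℕ → ℝ) (hs : ∀ k l, s k l = s l k) (K : ℕ) :
    ∑ k ∈ Finset.range K, ∑ l ∈ Finset.range K, s k l
      = ∑ k ∈ Finset.range K, s k k
        + 2 * ∑ l ∈ Finset.range K, ∑ k ∈ Finset.range l, s k l := by
  induction K with
  | zero => simp
  | succ K ih =>
    simp only [Finset.sum_range_succ, Finset.sum_add_distrib]
    rw [ih, Finset.sum_congr rfl fun l _ => hs K l]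
    ring

theorem lt_exponentCount_iff {F : Type*} [Field F] {g : F[X]} {n : ℕ} (hg : 1 ≤ g.natDegree) (hn : 1 ≤ n) (k : ℕ) :
    k < (n - 1) / g.natDegree + 1 ↔ k * g.natDegree < n := by
  rw [Nat.lt_succ_iff, Nat.le_div_iff_mul_le hg]
  omega

section Romanoff

variable {F : Type*} [Field F] [Fintype F] {g : F[X]} {n : ℕ}

open Classical in
/-- The polynomials `h + g ^ k` with `h` monic irreducible of degree `n` and `k deg g < n`. -/
noncomputable def romanoffFinset (n : ℕ) (g : F[X]) : Finset F[X] :=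
  (monicIrreducibles F n ×ˢ Finset.range ((n - 1) / g.natDegree + 1)).image fun p => p.1 + g ^ p.2

/-- The difference g^k of two monic polynomials of degree n has degree below n, which bounds k;
conversely such a g^k changes neither degree nor leading coefficient. -/
theorem romanoffSet_eq (hg : 1 ≤ g.natDegree) (hn : 1 ≤ n) :
    romanoffSet n g = (romanoffFinset n g : Set F[X]) := by
  classical
  have hg0 : g ≠ 0 := by rintro rfl; simp at hg
  ext f
  simp only [romanoffSet, romanoffFinset, Finset.coe_image, Set.mem_image, Finset.mem_coe,
    Finset.mem_product, Finset.mem_range, mem_monicIrreducibles, lt_exponentCount_iff hg hn,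
    Prod.exists]
  constructor
  · rintro ⟨hf, hfd, h, k, hm, hi, hd, rfl⟩
    refine ⟨h, k, ⟨⟨hm, hd, hi⟩, ?_⟩, rfl⟩
    have hlt := Polynomial.degree_sub_lt_left (p := h + g ^ k) (q := h)
      (by rw [Polynomial.degree_eq_natDegree hf.ne_zero, Polynomial.degree_eq_natDegree hm.ne_zero,
        hfd, hd]) hf.ne_zero (by rw [hf.leadingCoeff, hm.leadingCoeff])
    rw [add_sub_cancel_left, Polynomial.degree_eq_natDegree hf.ne_zero, hfd,
      Polynomial.degree_eq_natDegree (pow_ne_zero _ hg0), Polynomial.natDegree_pow] at hlt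
    exact_mod_cast hlt
  · rintro ⟨h, k, ⟨⟨hm, hd, hi⟩, hk⟩, rfl⟩
    have hlt : (g ^ k).degree < h.degree := by
      rw [Polynomial.degree_eq_natDegree hm.ne_zero, hd,
        Polynomial.degree_eq_natDegree (pow_ne_zero _ hg0), Polynomial.natDegree_pow]
      exact_mod_cast hk
    refine ⟨hm.add_of_left hlt, ?_, h, k, hm, hi, hd, rfl⟩
    rw [Polynomial.natDegree_add_eq_left_of_degree_lt hlt, hd]

theorem romanoffCount_eq (hg : 1 ≤ g.natDegree) (hn : 1 ≤ n) :
    romanoffCount n g = (romanoffFinset n g).card := by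
  rw [romanoffCount, romanoffSet_eq hg hn, Set.ncard_coe_finset]

theorem romanoffCount_le (hg : 1 ≤ g.natDegree) (hn : 1 ≤ n) :
    romanoffCount n g ≤ (monicIrreducibles F n).card * ((n - 1) / g.natDegree + 1) := by
  classical
  rw [romanoffCount_eq hg hn, romanoffFinset]
  refine Finset.card_image_le.trans ?_
  rw [Finset.card_product, Finset.card_range]

/-- The Cauchy-Schwarz lower bound for the number of representable polynomials. -/
theorem sq_le_romanoffCount_mul (hg : 1 ≤ g.natDegree) (hn : 1 ≤ n) (B : ℝ)
    (hB : ∀ l : ℕ, ∑ k ∈ Finset.range l, ∏ P ∈ primeDivisors (g ^ l - g ^ k), (1 + invNorm P)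
      ≤ l * B) (K : ℕ) (hK : K = (n - 1) / g.natDegree + 1) :
    (((monicIrreducibles F n).card : ℝ) * K) ^ 2 ≤ romanoffCount n g *
      (K * (monicIrreducibles F n).card + K * (K - 1) *
        (8 * ((Fintype.card F : ℝ) / (Fintype.card F - 1)) *
          ((Fintype.card F : ℝ) ^ n / n ^ 2) * B)) := by
  classical
  have hq : (2 : ℝ) ≤ Fintype.card F := by exact_mod_cast (Fintype.one_lt_card : 1 < Fintype.card F)
  have hg0 : g ≠ 0 := by rintro rfl; simp at hg
  have hKlt : ∀ k, k < K ↔ k * g.natDegree < n := fun k => hK ▸ lt_exponentCount_iff hg hn k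
  rw [romanoffCount_eq hg hn]
  set R := romanoffFinset n g with hR
  set I := monicIrreducibles F n with hI
  -- Summed over k < K this is the number of representations of f, the quantity to which
  -- Cauchy–Schwarz is applied.
  let r : ℕ → F[X] → ℝ := fun k f => if f - g ^ k ∈ I then 1 else 0
  have hrk : ∀ k < K, ∑ f ∈ R, r k f = I.card := by
    intro k hk
    simp only [r]
    rw [← Finset.sum_filter, Finset.sum_const, nsmul_eq_mul, mul_one]
    congr 1
    refine Finset.card_bij' (fun f _ => f - g ^ k) (fun h _ => h + g ^ k)
      (fun f hf => (Finset.mem_filter.1 hf).2) (fun h hh => ?_) (fun f _ => sub_add_cancel _ _)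
      fun h _ => add_sub_cancel_right _ _
    refine Finset.mem_filter.2 ⟨?_, by rwa [add_sub_cancel_right]⟩
    rw [hR, romanoffFinset, Finset.mem_image]
    exact ⟨(h, k), Finset.mem_product.2 ⟨hh, Finset.mem_range.2 (hK ▸ hk)⟩, rfl⟩
  have hrkl : ∀ k l, k < l → l < K → ∑ f ∈ R, r k f * r l f
      ≤ 8 * ((Fintype.card F : ℝ) / (Fintype.card F - 1)) * ((Fintype.card F : ℝ) ^ n / n ^ 2) *
        ∏ P ∈ primeDivisors (g ^ l - g ^ k), (1 + invNorm P) := by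
    intro k l hkl hl
    have hfac : g ^ l - g ^ k = g ^ k * (g ^ (l - k) - 1) := by
      rw [mul_sub, ← pow_add, mul_one]; congr 2; omega
    have hne : g ^ l - g ^ k ≠ 0 := by
      rw [hfac]; exact mul_ne_zero (pow_ne_zero _ hg0) (pow_sub_one_ne_zero_of_natDegree_pos hg (by omega))
    have hdeg : (g ^ l - g ^ k).natDegree < n := by
      rw [hfac, Polynomial.natDegree_mul (pow_ne_zero _ hg0) (pow_sub_one_ne_zero_of_natDegree_pos hg (by omega)),
        Polynomial.natDegree_pow, natDegree_pow_sub_one hg (by omega), ← add_mul,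
        show k + (l - k) = l by omega]
      exact (hKlt l).1 hl
    refine le_trans ?_ (card_twin_le hne n hn hdeg)
    have e : ∀ f, r k f * r l f = if f - g ^ k ∈ I ∧ f - g ^ l ∈ I then 1 else 0 := by
      intro f
      simp only [r]
      split_ifs <;> simp_all
    rw [Finset.sum_congr rfl fun f _ => e f, ← Finset.sum_filter, Finset.sum_const, nsmul_eq_mul,
      mul_one]
    norm_cast
    -- With h = f − g^l, the other irreducible f − g^k is h + (g^l − g^k).
    refine Finset.card_le_card_of_injOn (fun f => f - g ^ l) (fun f hf => ?_)
      fun f _ f' _ h => sub_left_injective h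
    obtain ⟨-, h1, h2⟩ := Finset.mem_filter.1 hf
    refine Finset.mem_coe.2 (Finset.mem_filter.2 ⟨h2, ?_⟩)
    rw [show f - g ^ l + (g ^ l - g ^ k) = f - g ^ k by ring]
    exact (mem_monicIrreducibles.1 h1).2.2
  have hcs := sq_sum_le_card_mul_sum_sq (s := R) (f := fun f => ∑ k ∈ Finset.range K, r k f)
  rw [Finset.sum_comm, Finset.sum_congr rfl fun k hk => hrk k (Finset.mem_range.1 hk),
    Finset.sum_const, Finset.card_range, nsmul_eq_mul, mul_comm] at hcs
  refine hcs.trans ?_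
  refine mul_le_mul_of_nonneg_left ?_ (Nat.cast_nonneg _)
  have e1 : ∑ f ∈ R, (∑ k ∈ Finset.range K, r k f) ^ 2
      = ∑ k ∈ Finset.range K, ∑ l ∈ Finset.range K, ∑ f ∈ R, r k f * r l f := by
    simp only [sq, Finset.sum_mul_sum]
    rw [Finset.sum_comm]
    exact Finset.sum_congr rfl fun k _ => Finset.sum_comm
  have e2 : ∀ k ∈ Finset.range K, ∑ f ∈ R, r k f * r k f = I.card := by
    intro k hk
    rw [← hrk k (Finset.mem_range.1 hk)]
    refine Finset.sum_congr rfl fun f _ => ?_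
    simp only [r]
    split_ifs <;> simp
  rw [e1, sum_range_sum_range_symm _ fun k l => Finset.sum_congr rfl fun f _ => mul_comm _ _,
    Finset.sum_congr rfl e2, Finset.sum_const, Finset.card_range, nsmul_eq_mul]
  set M := 8 * ((Fintype.card F : ℝ) / (Fintype.card F - 1)) * ((Fintype.card F : ℝ) ^ n / n ^ 2)
    with hM
  have hM0 : 0 ≤ M := by
    have : 0 < (Fintype.card F : ℝ) - 1 := by linarith
    positivity
  have e3 : ∑ l ∈ Finset.range K, ∑ k ∈ Finset.range l, ∑ f ∈ R, r k f * r l f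
      ≤ ∑ l ∈ Finset.range K, M * (l * B) := by
    refine Finset.sum_le_sum fun l hl => ?_
    refine (Finset.sum_le_sum fun k hk => hrkl k l (Finset.mem_range.1 hk)
      (Finset.mem_range.1 hl)).trans ?_
    rw [← Finset.mul_sum]
    exact mul_le_mul_of_nonneg_left (hB l) hM0
  have e4 : ∀ K : ℕ, ∑ l ∈ Finset.range K, M * ((l : ℝ) * B) = K * (K - 1) / 2 * (M * B) := by
    intro K
    induction K with
    | zero => simp
    | succ K ih => rw [Finset.sum_range_succ, ih]; push_cast; ring
  rw [e4] at e3
  linarith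

end Romanoff

/-- The prime polynomial theorem, in the squared form needed for the lower bound. -/
theorem sq_lt_sq_mul_card_monicIrreducibles_div (F : Type*) [Field F] [Fintype F] (n : ℕ)
    (hn : 1 ≤ n) :
    (1 - 2 * (Fintype.card F : ℝ) ^ (-(n : ℝ) / 2)) ^ 2
      < (n * (monicIrreducibles F n).card / (Fintype.card F : ℝ) ^ n) ^ 2 := by
  have hq : (2 : ℝ) ≤ Fintype.card F := by exact_mod_cast (Fintype.one_lt_card : 1 < Fintype.card F)
  set q : ℝ := (Fintype.card F : ℝ) with hqdef
  have hq0 : 0 < q := by linarith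
  set y : ℝ := q ^ (-(n : ℝ) / 2) with hy
  have hy0 : 0 < y := Real.rpow_pos_of_pos hq0 _
  have hy2 : y ^ 2 * q ^ n = 1 := by
    rw [hy, ← Real.rpow_natCast, ← Real.rpow_mul hq0.le, ← Real.rpow_natCast q n,
      ← Real.rpow_add hq0]
    norm_num
  -- For n = 1 the base 1 − 2y may be negative, but the right side is exactly 1 and 0 < y < 1. For n
  -- ≥ 2 one has y ≤ 1/2, so the inequality may be proved before squaring.
  rcases eq_or_lt_of_le hn with rfl | hn2
  · have h1 := sum_divisors_mul_card_monicIrreducibles F 1 one_ne_zero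
    simp only [Nat.divisors_one, Finset.sum_singleton, one_mul, pow_one] at h1
    rw [h1, ← hqdef]
    simp only [Nat.cast_one, one_mul, pow_one] at hy2 ⊢
    rw [div_self hq0.ne']
    have hy1 : y < 1 := by nlinarith
    nlinarith
  · have hqn : (4 : ℝ) ≤ q ^ n := by
      calc (4 : ℝ) = 2 ^ 2 := by norm_num
        _ ≤ q ^ 2 := by gcongr
        _ ≤ q ^ n := pow_le_pow_right₀ (by linarith) hn2
    have hyhalf : y ≤ 1 / 2 := by
      by_contra h
      push Not at h
      nlinarith [mul_pos hy0 hy0]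
    have hlow := lt_mul_card_monicIrreducibles F n (by omega)
    have hlow' : q ^ n < n * (monicIrreducibles F n).card + 2 * q ^ (n / 2) := by
      rw [hqdef]; exact_mod_cast hlow
    have hfl : q ^ (n / 2) ≤ y * q ^ n := by
      have h1 : (q ^ (n / 2)) ^ 2 ≤ q ^ n := by
        rw [← pow_mul]; exact pow_le_pow_right₀ (by linarith) (by omega)
      have h2 : (y * q ^ n) ^ 2 = q ^ n := by
        rw [mul_pow, sq (q ^ n), ← mul_assoc, hy2, one_mul]
      exact le_of_sq_le_sq (by rw [h2]; exact h1) (by positivity)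
    refine pow_lt_pow_left₀ ?_ (by linarith) two_ne_zero
    rw [lt_div_iff₀ (by positivity)]
    linarith

theorem theorem1 {F : Type*} [Field F] [Fintype F] (q n δ : ℕ) (g : F[X])
    (hq : Fintype.card F = q) (hδ : g.natDegree = δ) (hδ1 : 1 ≤ δ) (hn : 1 ≤ n) :
    romanoffDensity n g ≤ (1 + (δ : ℝ) / n) / δ ∧
    (1 - 2 * (q : ℝ) ^ (-(n : ℝ) / 2)) ^ 2 * (1 + (δ : ℝ) / n)⁻¹ /
        ((δ : ℝ) + 8 * ((q : ℝ) / ((q : ℝ) - 1)) *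
          (1 + Real.exp Real.eulerMascheroniConstant *
            min (5 * Real.sqrt ((δ : ℝ) / q)) (Real.log (6 * (δ : ℝ)) / Real.log q)))
      < romanoffDensity n g := by
  subst hq hδ
  have hq : (2 : ℝ) ≤ Fintype.card F := by exact_mod_cast (Fintype.one_lt_card : 1 < Fintype.card F)
  have hn0 : (0 : ℝ) < n := by exact_mod_cast hn
  have hδ0 : (0 : ℝ) < g.natDegree := by exact_mod_cast hδ1
  set δ : ℝ := (g.natDegree : ℝ) with hδ
  set q : ℝ := (Fintype.card F : ℝ) with hqdef
  have hqn : 0 < q ^ n := by positivity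
  set ϖ : ℝ := ((monicIrreducibles F n).card : ℝ) with hϖ
  obtain ⟨K, hK⟩ : ∃ K, K = (n - 1) / g.natDegree + 1 := ⟨_, rfl⟩
  have hϖle : n * ϖ ≤ q ^ n := by
    rw [hϖ, hqdef]; exact_mod_cast mul_card_monicIrreducibles_le F n
  have hK1 : (1 : ℝ) ≤ K := by
    have : 1 ≤ K := by rw [hK]; exact Nat.le_add_left 1 _
    exact_mod_cast this
  have hKub : (K - 1) * δ ≤ n := by
    have h1 := Nat.div_mul_le_self (n - 1) g.natDegree
    have h2 : (K - 1) * g.natDegree ≤ n := by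
      rw [hK, Nat.add_sub_cancel]; exact h1.trans (Nat.sub_le n 1)
    have h3 : (((K - 1) * g.natDegree : ℕ) : ℝ) ≤ n := by exact_mod_cast h2
    rwa [Nat.cast_mul, Nat.cast_sub (by exact_mod_cast hK1), Nat.cast_one] at h3
  have hKlb : (n : ℝ) ≤ K * δ := by
    have h := (lt_exponentCount_iff hδ1 hn K).not.1 (by rw [hK]; exact lt_irrefl _)
    rw [not_lt] at h
    rw [hδ]; exact_mod_cast h
  rw [romanoffDensity, ← hqdef]
  constructor
  · have h1 : (romanoffCount n g : ℝ) ≤ ϖ * K := by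
      rw [hϖ, hK]; exact_mod_cast romanoffCount_le hδ1 hn
    have e : (1 + δ / n) / δ = (n + δ) / (n * δ) := by field_simp
    rw [e, div_le_div_iff₀ hqn (by positivity)]
    calc (romanoffCount n g : ℝ) * (n * δ) ≤ ϖ * K * (n * δ) := by gcongr
      _ = (n * ϖ) * (K * δ) := by ring
      _ ≤ q ^ n * (n + δ) := by
        refine mul_le_mul hϖle (by linarith) (by positivity) hqn.le
      _ = (n + δ) * q ^ n := mul_comm _ _
  · set m := min (5 * √(δ / q)) (Real.log (6 * δ) / Real.log q) with hm
    have hδ1' : (1 : ℝ) ≤ δ := by rw [hδ]; exact_mod_cast hδ1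
    have hm0 : 0 ≤ m := le_min (by positivity)
      (div_nonneg (Real.log_nonneg (by linarith)) (Real.log_nonneg (by linarith)))
    set B := 1 + Real.exp Real.eulerMascheroniConstant * m with hB
    have hB0 : 0 < B := by positivity
    have hcs := sq_le_romanoffCount_mul hδ1 hn B (sum_prod_primeDivisors_le hδ1) K hK
    rw [← hqdef, ← hϖ] at hcs
    set C := 8 * (q / (q - 1)) * B with hC
    have hC0 : 0 < C := by
      have : 0 < q - 1 := by linarith
      positivity
    set R : ℝ := (romanoffCount n g : ℝ)
    have hR0 : 0 ≤ R := Nat.cast_nonneg _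
    have hu := sq_lt_sq_mul_card_monicIrreducibles_div F n hn
    rw [← hqdef, ← hϖ] at hu
    set u := 1 - 2 * q ^ (-(n : ℝ) / 2)
    set p := n * ϖ / q ^ n with hp
    have hϖp : ϖ = p * q ^ n / n := by rw [hp]; field_simp
    have hp1 : p ≤ 1 := by rw [hp, div_le_one hqn]; exact hϖle
    -- Cauchy–Schwarz divided by q^(2n) K / n², with the diagonal term bounded by nπ ≤ q^n.
    have hmain : p ^ 2 * K ≤ R / q ^ n * (n + (K - 1) * C) := by
      have e1 : K * ϖ + K * (K - 1) * (8 * (q / (q - 1)) * (q ^ n / n ^ 2) * B)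
          ≤ K * (q ^ n / n ^ 2) * (n + (K - 1) * C) := by
        have : K * ϖ ≤ K * (q ^ n / n) := by
          gcongr
          rw [le_div_iff₀ hn0]; linarith
        have e2 : K * (q ^ n / n ^ 2) * (n + (K - 1) * C)
            = K * (q ^ n / n) + K * (K - 1) * (8 * (q / (q - 1)) * (q ^ n / n ^ 2) * B) := by
          rw [hC]
          have : (n : ℝ) ≠ 0 := hn0.ne'
          have : q - 1 ≠ 0 := by linarith
          field_simp
        rw [e2]
        linarith
      have e3 := hcs.trans (mul_le_mul_of_nonneg_left e1 hR0)
      have hpos : 0 < (q ^ n) ^ 2 * K / (n : ℝ) ^ 2 := by positivity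
      refine le_of_mul_le_mul_left ?_ hpos
      calc (q ^ n) ^ 2 * K / (n : ℝ) ^ 2 * (p ^ 2 * K) = (ϖ * K) ^ 2 := by
            rw [hϖp]; field_simp
        _ ≤ R * (K * (q ^ n / n ^ 2) * (n + (K - 1) * C)) := e3
        _ = (q ^ n) ^ 2 * K / (n : ℝ) ^ 2 * (R / q ^ n * (n + (K - 1) * C)) := by
            field_simp
    have hD : 0 < (n : ℝ) + (K - 1) * C := by nlinarith
    have hr : p ^ 2 * K / (n + (K - 1) * C) ≤ R / q ^ n := (div_le_iff₀ hD).2 hmain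
    refine lt_of_lt_of_le ?_ hr
    have e : u ^ 2 * (1 + δ / n)⁻¹ / (δ + C) = u ^ 2 * n / ((n + δ) * (δ + C)) := by
      field_simp
    rw [e, div_lt_div_iff₀ (by positivity) hD]
    have hp0 : 0 < p ^ 2 := lt_of_le_of_lt (sq_nonneg u) hu
    -- From n ≤ Kδ the left side is already at most K n (δ + C); the factor 1 + δ/n is slack.
    have h1 : (n : ℝ) * (n + (K - 1) * C) ≤ K * ((n + δ) * (δ + C)) := by
      have a1 := mul_le_mul_of_nonneg_left hKlb hn0.le
      have a2 : 0 ≤ (n : ℝ) * C := by positivity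
      have a3 : 0 ≤ K * δ * (δ + C) := by positivity
      nlinarith
    calc u ^ 2 * n * (n + (K - 1) * C) < p ^ 2 * n * (n + (K - 1) * C) :=
          mul_lt_mul_of_pos_right (mul_lt_mul_of_pos_right hu hn0) hD
      _ = p ^ 2 * (n * (n + (K - 1) * C)) := by ring
      _ ≤ p ^ 2 * (K * ((n + δ) * (δ + C))) :=
          mul_le_mul_of_nonneg_left h1 hp0.le
      _ = p ^ 2 * K * ((n + δ) * (δ + C)) := by ring
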